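/- Let $\mathcal X$ be a finite alphabet and, for $n\ge 1$, let $\mathcal P(\mathcal X^n)$ be the set of probability distributions on $\mathcal X^n$. Let $(\mathcal F_n)_{n\ge1}$, $\mathcal F_n\subseteq\mathcal P(\mathcal X^n)$, satisfy the (classical) Brandão–Plenio axioms: (1) each $\mathcal F_n$ is convex and closed; (2) there are $c>0$ and $q_0\in\mathcal F_1$ with $q_0(x)\ge c$ for all $x\in\mathcal X$; (3) if $q\in\mathcal F_{n+1}$, then its marginal on the first $n$ letters is in $\mathcal F_n$; (4) if $q\in\mathcal F_n$ and $q'\in\mathcal F_m$, then $q\otimes q'\in\mathcal F_{n+m}$; (5) each $\mathcal F_n$ is invariant under permutations of the $n$ letters. All logarithms are to base $2$. For distributions $p,q$ on a finite set put $$D_{\max}(p\|q)=\min\{\lambda\in\mathbb R:\ p\le 2^\lambda q \text{ pointwise}\},\qquad D_{\max}^\varepsilon(p\|q)=\min_{p':\ \frac12\|p-p'\|_1\le\varepsilon}D_{\max}(p'\|q)$$ with $p'$ ranging over probability distributions, $$D(p\|q)=\sum_x p(x)\log\frac{p(x)}{q(x)},\qquad D_H^\varepsilon(p\|q)=-\log\min\Big\{\sum_x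 Q(x)q(x):\ 0\le Q\le1,\ \sum_xQ(x)p(x)\ge1-\varepsilon\Big\},$$ with value $+\infty$ where appropriate, and $\mathbb D(p\|\mathcal F)=\inf_{q\in\mathcal F}\mathbb D(p\|q)$ for a set $\mathcal F$ and each of these quantities $\mathbb D$. For $p\in\mathcal P(\mathcal X)$ put $$D^\infty(p\|\mathcal F)=\lim_{n\to\infty}\frac1nD(p^{\otimes n}\|\mathcal F_n),\qquad \mathrm{Stein}(p\|\mathcal F)=\lim_{\varepsilon\to0^+}\liminf_{n\to\infty}\frac1nD_H^\varepsilon(p^{\otimes n}\|\mathcal F_n),$$ and let $g(x)=(x+1)\log(x+1)-x\log x$, $g(0)=0$. Let $p\in\mathcal P(\mathcal X)$. Then for all integers $n\ge1$ and all $\eta,\varepsilon\in(0,1)$ with $\eta+\varepsilon<1$, $$D_{\max}^\eta(p^{\otimes n}\|\mathcal F_n)\le D_{\max}^\varepsilon(p^{\otimes n}\|\mathcal F_n)+\log\frac1{1-\varepsilon-\eta}+2n\,g\Big(\big(2\delta_n+\tfrac1n\big)|\mathcal X|\Big)+(2n\delta_n+1)|\mathcal X|\log\frac1c,$$ where $\delta_n=\sqrt{\frac{|\mathcal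 X|}{2n}\log\frac{n+1}{\eta}}$. In particular the limits defining $D^\infty(p\|\mathcal F)$ and $\mathrm{Stein}(p\|\mathcal F)$ exist, are finite, and $$\lim_{n\to\infty}\frac1nD_{\max}^\varepsilon(p^{\otimes n}\|\mathcal F_n)=D^\infty(p\|\mathcal F)=\mathrm{Stein}(p\|\mathcal F)\qquad\text{for every }\varepsilon\in(0,1).$$ -/

import Mathlib

open Filter Topology

noncomputable section

namespace GenStein

/-! Probability distributions on a finite set `Ω` are the elements of `stdSimplex ℝ Ω`, and
distributions on words of length `n` over `X` are elements of `stdSimplex ℝ (Fin n → X)`.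
Entropic quantities take values in `EReal`; all logarithms are to base `2`. -/

/-- Product of distributions on words of length `n` and `m`, on words of length `n + m`. -/
def tensor {X : Type*} {n m : ℕ} (p : (Fin n → X) → ℝ) (q : (Fin m → X) → ℝ) :
    (Fin (n + m) → X) → ℝ :=
  fun x => p (fun i => x (Fin.castAdd m i)) * q (fun j => x (Fin.natAdd n j))

/-- Marginal on the first `n` letters (the last letter is summed over). -/
def marginal {X : Type*} [Fintype X] {n : ℕ} (q : (Fin (n + 1) → X) → ℝ) :
    (Fin n → X) → ℝ :=
  fun x => ∑ a : X, q (Fin.snoc (α := fun _ => X) x a)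

/-- The i.i.d. distribution `p^{⊗ n}`. -/
def iid {X : Type*} (p : X → ℝ) (n : ℕ) : (Fin n → X) → ℝ :=
  fun x => ∏ i, p (x i)

/-- The (classical) Brandão–Plenio axioms for a family `F n`, `n ≥ 1`, of sets of distributions on
words of length `n`, with `c` the constant bounding from below a full-support element of `F 1`.
The value `F 0` is irrelevant. -/
structure BrandaoPlenio {X : Type*} [Fintype X] (F : (n : ℕ) → Set ((Fin n → X) → ℝ)) (c : ℝ) :
    Prop where
  subset_simplex : ∀ n, 1 ≤ n → F n ⊆ stdSimplex ℝ (Fin n → X)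
  convex : ∀ n, 1 ≤ n → Convex ℝ (F n)
  closed : ∀ n, 1 ≤ n → IsClosed (F n)
  c_pos : 0 < c
  full_support : ∃ q₀ ∈ F 1, ∀ x, c ≤ q₀ x
  marginal_mem : ∀ n, 1 ≤ n → ∀ q ∈ F (n + 1), marginal q ∈ F n
  tensor_mem : ∀ n m, 1 ≤ n → 1 ≤ m → ∀ q ∈ F n, ∀ q' ∈ F m, tensor q q' ∈ F (n + m)
  perm_mem : ∀ n, 1 ≤ n → ∀ q ∈ F n, ∀ π : Equiv.Perm (Fin n),
    (fun x : Fin n → X => q (x ∘ π)) ∈ F n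

/-- Total variation distance. -/
def tvDist {Ω : Type*} [Fintype Ω] (p q : Ω → ℝ) : ℝ := (1 / 2) * ∑ x, |p x - q x|

/-- Max-relative entropy: the least `l` with `p ≤ 2 ^ l • q` pointwise (`⊤` if there is none). -/
def dMax {Ω : Type*} (p q : Ω → ℝ) : EReal :=
  sInf ((fun l : ℝ => (l : EReal)) '' {l : ℝ | ∀ x, p x ≤ (2 : ℝ) ^ l * q x})

/-- Smoothed max-relative entropy, the smoothing being over normalised distributions. -/
def dMaxSmooth {Ω : Type*} [Fintype Ω] (ε : ℝ) (p q : Ω → ℝ) : EReal :=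
  ⨅ p' ∈ {p' : Ω → ℝ | p' ∈ stdSimplex ℝ Ω ∧ tvDist p p' ≤ ε}, dMax p' q

open Classical in
/-- Relative entropy (Kullback–Leibler divergence) in bits. -/
def relEnt {Ω : Type*} [Fintype Ω] (p q : Ω → ℝ) : EReal :=
  if ∀ x, q x = 0 → p x = 0 then ((∑ x, p x * Real.logb 2 (p x / q x) : ℝ) : EReal) else ⊤

/-- `-log₂ t` for `t ≥ 0`, with `-log₂ 0 = ⊤`. -/
def negLog (t : ℝ) : EReal :=
  if t = 0 then ⊤ else ((-Real.logb 2 t : ℝ) : EReal)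

/-- Hypothesis testing relative entropy: `-log₂` of the least type-II error of a (randomised) test
whose type-I error is at most `ε`. -/
def dHyp {Ω : Type*} [Fintype Ω] (ε : ℝ) (p q : Ω → ℝ) : EReal :=
  negLog (sInf {t : ℝ | ∃ Q : Ω → ℝ,
    (∀ x, 0 ≤ Q x ∧ Q x ≤ 1) ∧ 1 - ε ≤ ∑ x, Q x * p x ∧ t = ∑ x, Q x * q x})

/-- A divergence of a distribution from a set of distributions. -/
def toSet {Ω : Type*} (D : (Ω → ℝ) → (Ω → ℝ) → EReal) (p : Ω → ℝ) (S : Set (Ω → ℝ)) : EReal :=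
  ⨅ q ∈ S, D p q

/-- `(1/n) D_max^ε(p^{⊗ n} ‖ F n)`. -/
def dMaxRate {X : Type*} [Fintype X] (ε : ℝ) (p : X → ℝ) (F : (n : ℕ) → Set ((Fin n → X) → ℝ))
    (n : ℕ) : EReal :=
  (((n : ℝ)⁻¹ : ℝ) : EReal) * toSet (dMaxSmooth ε) (iid p n) (F n)

/-- `(1/n) D(p^{⊗ n} ‖ F n)`. -/
def relEntRate {X : Type*} [Fintype X] (p : X → ℝ) (F : (n : ℕ) → Set ((Fin n → X) → ℝ))
    (n : ℕ) : EReal :=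
  (((n : ℝ)⁻¹ : ℝ) : EReal) * toSet relEnt (iid p n) (F n)

/-- `(1/n) D_H^ε(p^{⊗ n} ‖ F n)`. -/
def dHypRate {X : Type*} [Fintype X] (ε : ℝ) (p : X → ℝ) (F : (n : ℕ) → Set ((Fin n → X) → ℝ))
    (n : ℕ) : EReal :=
  (((n : ℝ)⁻¹ : ℝ) : EReal) * toSet (dHyp ε) (iid p n) (F n)

/-- Regularised relative entropy `lim_n (1/n) D(p^{⊗ n} ‖ F n)`. -/
def regRelEnt {X : Type*} [Fintype X] (p : X → ℝ) (F : (n : ℕ) → Set ((Fin n → X) → ℝ)) : EReal :=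
  limUnder atTop (relEntRate p F)

/-- Stein exponent `lim_{ε → 0⁺} liminf_n (1/n) D_H^ε(p^{⊗ n} ‖ F n)`. -/
def stein {X : Type*} [Fintype X] (p : X → ℝ) (F : (n : ℕ) → Set ((Fin n → X) → ℝ)) : EReal :=
  limUnder (𝓝[>] (0 : ℝ)) (fun ε => liminf (dHypRate ε p F) atTop)

/-- Bosonic entropy function (`g 0 = 0`). -/
def g (x : ℝ) : ℝ := (x + 1) * Real.logb 2 (x + 1) - x * Real.logb 2 x

/-- `δ_n = √(k / (2 n) · log₂ ((n + 1) / η))`, where `k` is the size of the alphabet. -/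
def delta (k n : ℕ) (η : ℝ) : ℝ := √((k : ℝ) / (2 * n) * Real.logb 2 ((n + 1) / η))

end GenStein

end

/-! The core is a blurring argument. Let `q ∈ F n` satisfy `p' ≤ 2 ^ l * q` with `p'` within `ε` of
`p^{⊗ n}`, and let `T` be the typical set: words whose letter counts are within `nδ` of their means.
Then `T` has `p^{⊗ n}`-mass at least `1 - η`, so `q` gives it at least `2 ^ (-l) * (1 - ε - η)`,
though possibly concentrated on few types. To spread this mass, append `k` letters drawn from a
full-support free product, permute all `n + k` positions at random and discard the last `k`; the
axioms keep the result `σ` in `F n`. If the appended word contains every letter about `2nδ` times,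
then every word of `T` followed by it can be rearranged to start with any given `x ∈ T`. Hence `σ`
gives each type class in `T` at least `q(T)`, up to a factor `c ^ k` and a binomial coefficient,
both subexponential in `n`. Both `σ` and `p^{⊗ n}` are constant on type classes, so `p^{⊗ n}` is
dominated by a multiple of `σ` on `T`, and conditioning on `T` gives the one-shot bound
(`exists_mem_forall_typicalSet_le`, `toSet_dMaxSmooth_le`).

For the limits, `D(p^{⊗ n} ‖ F n)` is subadditive, so Fekete's lemma gives `D^∞`. Mixing `σ` with a
full-support product bounds the relative entropy by the smooth max-relative entropy
(`toSet_relEnt_le`). Conversely, Markov's inequality bounds the latter by `D / θ` plus constants for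
smoothing `θ` near `1`, and the one-shot bound carries this to every smoothing parameter. Finally
`D_H^ε` lies, up to constants, between smooth max-relative entropies with parameters in `(0, 1)`, so
its rate has the same limit for each `ε`. -/

noncomputable section

namespace GenStein

/-! ### Words, letter counts, type classes and permutations of positions. -/

section Words

variable {X : Type*}

lemma sum_append {M : Type*} [AddCommMonoid M] [Fintype X] {n k : ℕ} (f : (Fin (n + k) → X) → M) :
    ∑ u, f u = ∑ x : Fin n → X, ∑ z : Fin k → X, f (Fin.append x z) := by
  rw [← Fintype.sum_prod_type', ← (Fin.appendEquiv n k).sum_comp]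
  rfl

lemma sum_snoc {M : Type*} [AddCommMonoid M] [Fintype X] {n : ℕ} (f : (Fin (n + 1) → X) → M) :
    ∑ u, f u = ∑ z : Fin n → X, ∑ a : X, f (Fin.snoc (α := fun _ => X) z a) := by
  rw [← (Fin.snocEquiv fun _ => X).sum_comp, Fintype.sum_prod_type, Finset.sum_comm]
  rfl

@[simp] lemma tensor_append {n k : ℕ} (q : (Fin n → X) → ℝ) (r : (Fin k → X) → ℝ)
    (y : Fin n → X) (w : Fin k → X) : tensor q r (Fin.append y w) = q y * r w := by
  simp [tensor]

lemma iid_append (p : X → ℝ) {n k : ℕ} (y : Fin n → X) (w : Fin k → X) :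
    iid p (n + k) (Fin.append y w) = iid p n y * iid p k w := by
  simp [iid, Fin.prod_univ_add]

lemma tensor_iid (p : X → ℝ) (n k : ℕ) : tensor (iid p n) (iid p k) = iid p (n + k) := by
  ext x
  simp [tensor, iid, Fin.prod_univ_add]

lemma iid_comp_perm (p : X → ℝ) {n : ℕ} (x : Fin n → X) (π : Equiv.Perm (Fin n)) :
    iid p n (x ∘ π) = iid p n x := by
  simp only [iid, Function.comp_apply]
  exact Equiv.prod_comp π fun i => p (x i)

lemma iid_nonneg {p : X → ℝ} (hp : ∀ a, 0 ≤ p a) {n : ℕ} (x : Fin n → X) : 0 ≤ iid p n x :=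
  Finset.prod_nonneg fun _ _ => hp _

lemma pow_le_iid {p : X → ℝ} {c : ℝ} (hc : 0 ≤ c) (hp : ∀ a, c ≤ p a) {n : ℕ} (x : Fin n → X) :
    c ^ n ≤ iid p n x := by
  have := Finset.prod_le_prod (s := Finset.univ) (fun (_ : Fin n) _ => hc) fun i _ => hp (x i)
  simpa [iid] using this

lemma iid_mem_stdSimplex [Fintype X] {p : X → ℝ} (hp : p ∈ stdSimplex ℝ X) (n : ℕ) :
    iid p n ∈ stdSimplex ℝ (Fin n → X) := by
  classical
  refine ⟨fun x => iid_nonneg hp.1 x, ?_⟩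
  have := Finset.prod_univ_sum (fun _ : Fin n => (Finset.univ : Finset X)) fun _ a => p a
  simp only [hp.2, Finset.prod_const_one, Fintype.piFinset_univ] at this
  exact this.symm

/-- The number of occurrences of the letter `a` in the word `x`. -/
def letterCount [DecidableEq X] {n : ℕ} (x : Fin n → X) (a : X) : ℕ :=
  ∑ i, if x i = a then 1 else 0

lemma letterCount_eq_card [DecidableEq X] {n : ℕ} (x : Fin n → X) (a : X) :
    letterCount x a = Fintype.card {i // x i = a} := by
  simp [letterCount, Fintype.card_subtype]

lemma letterCount_append [DecidableEq X] {n k : ℕ} (y : Fin n → X) (w : Fin k → X) (a : X) :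
    letterCount (Fin.append y w) a = letterCount y a + letterCount w a := by
  simp only [letterCount, Fin.sum_univ_add, Fin.append_left, Fin.append_right]

lemma letterCount_comp_perm [DecidableEq X] {n : ℕ} (x : Fin n → X) (π : Equiv.Perm (Fin n))
    (a : X) : letterCount (x ∘ π) a = letterCount x a :=
  Equiv.sum_comp π fun i => if x i = a then 1 else 0

/-- There is a word containing each letter exactly `m` times. -/
lemma exists_word_letterCount_eq [DecidableEq X] [Fintype X] (m : ℕ) :
    ∃ w : Fin (m * Fintype.card X) → X, ∀ a, letterCount w a = m := by
  let e : Fin (m * Fintype.card X) ≃ Fin m × X :=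
    finProdFinEquiv.symm.trans (Equiv.prodCongrRight fun _ => (Fintype.equivFin X).symm)
  refine ⟨fun i => (e i).2, fun a => ?_⟩
  rw [letterCount, e.sum_comp fun b => if b.2 = a then 1 else 0, Fintype.sum_prod_type]
  simp

/-- If every letter occurs in `u` at least as often as in `x`, some permutation of `u` starts
with `x`. -/
lemma exists_perm_prefix [DecidableEq X] {n k : ℕ} (x : Fin n → X) (u : Fin (n + k) → X)
    (h : ∀ a, letterCount x a ≤ letterCount u a) :
    ∃ π : Equiv.Perm (Fin (n + k)), ∀ i, u (π (Fin.castAdd k i)) = x i := by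
  have hf : ∀ a, Nonempty ({i // x i = a} ↪ {j // u j = a}) := fun a =>
    Function.Embedding.nonempty_of_card_le (by
      simpa only [← letterCount_eq_card] using h a)
  let f := fun a => (hf a).some
  have hfu : ∀ i, u (f (x i) ⟨i, rfl⟩) = x i := fun i => (f (x i) ⟨i, rfl⟩).2
  have hinj : Function.Injective fun i => ((f (x i) ⟨i, rfl⟩ : {j // u j = x i}) : Fin (n + k)) := by
    intro i i' hii
    have hx : x i = x i' := by rw [← hfu i, ← hfu i']; exact congrArg u hii
    -- The embeddings `f (x i)` and `f (x i')` have different types; a common letter `a` makes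
    -- injectivity of `f a` applicable.
    have key : ∀ a (hi : x i = a) (hi' : x i' = a),
        ((f a ⟨i, hi⟩ : {j // u j = a}) : Fin (n + k)) = f a ⟨i', hi'⟩ → i = i' := by
      intro a hi hi' h
      simpa using (f a).injective (Subtype.ext h)
    refine key (x i') hx rfl ?_
    have : ∀ a (hi : x i = a), ((f a ⟨i, hi⟩ : {j // u j = a}) : Fin (n + k)) =
        f (x i) ⟨i, rfl⟩ := by
      rintro a rfl; rfl
    exact (this _ _).trans hii
  obtain ⟨π, hπ⟩ := Equiv.Perm.exists_extending_pair (Fin.castAdd k)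
    (fun i => ((f (x i) ⟨i, rfl⟩ : {j // u j = x i}) : Fin (n + k)))
    (Fin.castAdd_injective n k) hinj
  refine ⟨π, fun i => ?_⟩
  have : π (Fin.castAdd k i) = f (x i) ⟨i, rfl⟩ := hπ i
  rw [this, hfu]

/-- The permutation of `n + k` positions acting by `α` on the first `n` and by `β` on the
last `k` ones. -/
def blockPerm {n k : ℕ} (α : Equiv.Perm (Fin n)) (β : Equiv.Perm (Fin k)) :
    Equiv.Perm (Fin (n + k)) :=
  finSumFinEquiv.permCongr (Equiv.sumCongr α β)

@[simp] lemma blockPerm_castAdd {n k : ℕ} (α : Equiv.Perm (Fin n)) (β : Equiv.Perm (Fin k))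
    (i : Fin n) : blockPerm α β (Fin.castAdd k i) = Fin.castAdd k (α i) := by
  simp [blockPerm, Equiv.permCongr_apply]

@[simp] lemma blockPerm_natAdd {n k : ℕ} (α : Equiv.Perm (Fin n)) (β : Equiv.Perm (Fin k))
    (i : Fin k) : blockPerm α β (Fin.natAdd n i) = Fin.natAdd n (β i) := by
  simp [blockPerm, Equiv.permCongr_apply]

lemma blockPerm_injective {n k : ℕ} : Function.Injective fun ab : Equiv.Perm (Fin n) ×
    Equiv.Perm (Fin k) => blockPerm ab.1 ab.2 := by
  rintro ⟨α, β⟩ ⟨α', β'⟩ h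
  refine Prod.ext (Equiv.ext fun i => ?_) (Equiv.ext fun i => ?_)
  · have := DFunLike.congr_fun h (Fin.castAdd k i)
    simpa using this
  · have := DFunLike.congr_fun h (Fin.natAdd n i)
    simpa using this

lemma append_comp_blockPerm {n k : ℕ} (x : Fin n → X) (z : Fin k → X) (α : Equiv.Perm (Fin n)) :
    Fin.append x z ∘ blockPerm α 1 = Fin.append (x ∘ α) z := by
  ext i
  induction i using Fin.addCases <;> simp

/-- The rearrangements of the word `x`. -/
def typeClass [Fintype X] [DecidableEq X] {n : ℕ} (x : Fin n → X) : Finset (Fin n → X) :=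
  Finset.univ.filter fun x' => ∃ α : Equiv.Perm (Fin n), x ∘ α = x'

lemma mem_typeClass_self [Fintype X] [DecidableEq X] {n : ℕ} (x : Fin n → X) :
    x ∈ typeClass x := by
  simp only [typeClass, Finset.mem_filter, Finset.mem_univ, true_and]
  exact ⟨1, rfl⟩

lemma sum_typeClass [Fintype X] [DecidableEq X] {n : ℕ} {f : (Fin n → X) → ℝ}
    (hf : ∀ x (α : Equiv.Perm (Fin n)), f (x ∘ α) = f x) (x : Fin n → X) :
    ∑ x' ∈ typeClass x, f x' = (typeClass x).card * f x := by
  rw [← nsmul_eq_mul, ← Finset.sum_const]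
  refine Finset.sum_congr rfl fun x' hx' => ?_
  obtain ⟨α, rfl⟩ := (Finset.mem_filter.1 hx').2
  exact hf x α

/-- If some permutation of `u` starts with `x`, a fraction of at least `1 / (n + k).choose n` of
all permutations starts with a rearrangement of `x`. -/
lemma factorial_mul_le_card_perm [Fintype X] [DecidableEq X] {n k : ℕ} (x : Fin n → X)
    (u : Fin (n + k) → X)
    (h : ∃ π : Equiv.Perm (Fin (n + k)), ∀ i, u (π (Fin.castAdd k i)) = x i) :
    n.factorial * k.factorial ≤ (Finset.univ.filter fun π : Equiv.Perm (Fin (n + k)) =>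
      (fun i => u (π (Fin.castAdd k i))) ∈ typeClass x).card := by
  obtain ⟨π, hπ⟩ := h
  have hcard : n.factorial * k.factorial =
      (Finset.univ : Finset (Equiv.Perm (Fin n) × Equiv.Perm (Fin k))).card := by
    simp [Fintype.card_perm]
  rw [hcard]
  -- Shuffling the first `n` and the last `k` positions separately before applying `π` turns the
  -- prefix `x` into `x ∘ α`, still in the type class.
  refine Finset.card_le_card_of_injOn (fun ab => π * blockPerm ab.1 ab.2) ?_ ?_
  · rintro ⟨α, β⟩ -
    simp only [typeClass, Finset.coe_filter, Finset.mem_filter, Finset.mem_univ, true_and,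
      Set.mem_ofPred_eq]
    exact ⟨α, by ext i; simp [hπ]⟩
  · intro a _ b _ hab
    exact blockPerm_injective (mul_left_cancel hab)

/-- Average over all permutations of the positions. -/
def permAverage {n : ℕ} (q : (Fin n → X) → ℝ) : (Fin n → X) → ℝ :=
  fun x => ∑ π : Equiv.Perm (Fin n), (n.factorial : ℝ)⁻¹ * q (x ∘ π)

lemma permAverage_comp_perm {n : ℕ} (q : (Fin n → X) → ℝ) (x : Fin n → X)
    (α : Equiv.Perm (Fin n)) : permAverage q (x ∘ α) = permAverage q x := by
  simp only [permAverage]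
  exact Equiv.sum_comp (Equiv.mulLeft α)
    fun π : Equiv.Perm (Fin n) => (n.factorial : ℝ)⁻¹ * q (x ∘ π)

end Words

/-! ### Operations that preserve the free sets, and the blurring estimate. -/

section Axioms

variable {X : Type*} [Fintype X] {F : (n : ℕ) → Set ((Fin n → X) → ℝ)} {c : ℝ}

/-- Marginal on the first `n` letters of a word of length `n + k`. -/
def prefixMarginal {n : ℕ} (k : ℕ) (q : (Fin (n + k) → X) → ℝ) : (Fin n → X) → ℝ :=
  fun x => ∑ z : Fin k → X, q (Fin.append x z)

lemma BrandaoPlenio.prefixMarginal_mem (hF : BrandaoPlenio F c) {n : ℕ} (hn : 1 ≤ n) (k : ℕ)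
    (q : (Fin (n + k) → X) → ℝ) (hq : q ∈ F (n + k)) : prefixMarginal k q ∈ F n := by
  induction k with
  | zero =>
    have : prefixMarginal 0 q = q := by
      ext x
      simp only [prefixMarginal, Finset.univ_unique, Finset.sum_singleton]
      exact congrArg q (Fin.append_right_nil x _ rfl)
    rwa [this]
  | succ k ih =>
    have : prefixMarginal (k + 1) q = prefixMarginal k (marginal (n := n + k) q) := by
      ext x
      simp only [prefixMarginal, marginal]
      rw [sum_snoc]
      simp only [Fin.append_snoc]
    rw [this]
    exact ih _ (hF.marginal_mem (n + k) (by omega) q hq)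

lemma BrandaoPlenio.permAverage_mem (hF : BrandaoPlenio F c) {n : ℕ} (hn : 1 ≤ n)
    (q : (Fin n → X) → ℝ) (hq : q ∈ F n) : permAverage q ∈ F n := by
  have := (hF.convex n hn).sum_mem (t := Finset.univ)
    (w := fun _ : Equiv.Perm (Fin n) => (n.factorial : ℝ)⁻¹)
    (z := fun π x => q (x ∘ π)) (fun _ _ => by positivity)
    (by simp [Fintype.card_perm, Nat.factorial_ne_zero]) fun π _ => hF.perm_mem n hn q hq π
  convert this using 1
  ext x
  simp [permAverage, Finset.sum_apply]

/-- A permutation of the prefix extends by the identity to all positions, where the average is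
invariant. This makes the blurred distribution constant on type classes. -/
lemma prefixMarginal_permAverage_comp_perm {n k : ℕ} (q : (Fin (n + k) → X) → ℝ) (x : Fin n → X)
    (α : Equiv.Perm (Fin n)) : prefixMarginal k (permAverage q) (x ∘ α) =
      prefixMarginal k (permAverage q) x := by
  simp only [prefixMarginal]
  refine Finset.sum_congr rfl fun z _ => ?_
  rw [← append_comp_blockPerm, permAverage_comp_perm]

/-- The single-letter distribution underlying an element of `F 1`, with all its powers free. -/
lemma BrandaoPlenio.exists_iid_mem (hF : BrandaoPlenio F c) :
    ∃ q₀ : X → ℝ, (∀ a, c ≤ q₀ a) ∧ ∀ n, 1 ≤ n → iid q₀ n ∈ F n := by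
  obtain ⟨q, hq, hc⟩ := hF.full_support
  refine ⟨fun a => q fun _ => a, fun a => hc _, fun n hn => ?_⟩
  have h1 : iid (fun a => q fun _ => a) 1 = q := by
    ext x
    simp only [iid, Finset.univ_unique, Finset.prod_singleton]
    congr 1
    ext i
    rw [Subsingleton.elim i default]
  induction n, hn using Nat.le_induction with
  | base => rwa [h1]
  | succ n hn ih =>
    rw [← tensor_iid]
    exact hF.tensor_mem n 1 hn le_rfl _ ih _ (by rwa [h1])

/-- Blurring: if `τ` dominates `r` on the words `y ++ w` with `y ∈ T`, and each `y ++ w` can be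
rearranged to start with `x`, then the blurred distribution gives the type class of `x` weight
at least that of `r` on `T`, up to a binomial coefficient. -/
lemma sum_le_choose_mul_sum_typeClass [DecidableEq X] {n k : ℕ} (τ : (Fin (n + k) → X) → ℝ)
    (hτ : ∀ u, 0 ≤ τ u) (r : (Fin n → X) → ℝ) (w : Fin k → X)
    (T : Finset (Fin n → X)) (hrτ : ∀ y ∈ T, r y ≤ τ (Fin.append y w)) (x : Fin n → X)
    (hx : ∀ y ∈ T, ∃ π : Equiv.Perm (Fin (n + k)),
      ∀ i, Fin.append y w (π (Fin.castAdd k i)) = x i) :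
    ∑ y ∈ T, r y ≤ (n + k).choose n *
      ∑ x' ∈ typeClass x, prefixMarginal k (permAverage τ) x' := by
  -- The mass of the type class is the probability that a `τ`-random word, randomly permuted, starts
  -- with a rearrangement of `x`.
  have hexp : ∑ x' ∈ typeClass x, prefixMarginal k (permAverage τ) x' =
      ((n + k).factorial : ℝ)⁻¹ * ∑ v : Fin (n + k) → X,
        τ v * (Finset.univ.filter fun π : Equiv.Perm (Fin (n + k)) =>
          (fun i => v (π (Fin.castAdd k i))) ∈ typeClass x).card := by
    have h1 : ∑ x' ∈ typeClass x, prefixMarginal k (permAverage τ) x' =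
        ∑ u : Fin (n + k) → X,
          if (fun i => u (Fin.castAdd k i)) ∈ typeClass x then permAverage τ u else 0 := by
      rw [sum_append, ← Finset.sum_filter_add_sum_filter_not Finset.univ (· ∈ typeClass x)]
      have h0 : ∑ y ∈ Finset.univ.filter (· ∉ typeClass x), ∑ z : Fin k → X,
          (if (fun i => (Fin.append y z) (Fin.castAdd k i)) ∈ typeClass x
            then permAverage τ (Fin.append y z) else 0) = 0 := by
        refine Finset.sum_eq_zero fun y hy => Finset.sum_eq_zero fun z _ => ?_
        simp only [Fin.append_left]
        rw [if_neg (Finset.mem_filter.1 hy).2]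
      rw [h0, add_zero, Finset.filter_univ_mem]
      refine Finset.sum_congr rfl fun y hy => ?_
      simp only [Fin.append_left]
      simp [hy, prefixMarginal]
    rw [h1, Finset.mul_sum]
    simp only [permAverage, ← Finset.sum_boole, Finset.mul_sum]
    calc _ = ∑ u : Fin (n + k) → X, ∑ π : Equiv.Perm (Fin (n + k)),
          if (fun i => u (Fin.castAdd k i)) ∈ typeClass x then
            ((n + k).factorial : ℝ)⁻¹ * τ (u ∘ π) else 0 := by
          refine Finset.sum_congr rfl fun u _ => ?_
          split_ifs <;> simp
      _ = ∑ π : Equiv.Perm (Fin (n + k)), ∑ u : Fin (n + k) → X,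
          if (fun i => u (π⁻¹ (Fin.castAdd k i))) ∈ typeClass x then
            ((n + k).factorial : ℝ)⁻¹ * τ u else 0 := by
          rw [Finset.sum_comm]
          refine Finset.sum_congr rfl fun π _ => ?_
          -- Substituting `u ∘ π⁻¹` for the word moves the permutation from the argument of `τ` to
          -- the prefix condition; the next equality replaces `π⁻¹` by `π`.
          rw [← (Equiv.arrowCongr π (Equiv.refl X)).sum_comp]
          refine Finset.sum_congr rfl fun u _ => ?_
          have : (Equiv.arrowCongr π (Equiv.refl X)) u ∘ π = u := by ext i; simp
          rw [this]
          rfl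
      _ = ∑ π : Equiv.Perm (Fin (n + k)), ∑ u : Fin (n + k) → X,
          if (fun i => u (π (Fin.castAdd k i))) ∈ typeClass x then
            ((n + k).factorial : ℝ)⁻¹ * τ u else 0 :=
          Equiv.sum_comp (Equiv.inv (Equiv.Perm (Fin (n + k))))
            fun π : Equiv.Perm (Fin (n + k)) => ∑ u : Fin (n + k) → X,
            if (fun i => u (π (Fin.castAdd k i))) ∈ typeClass x then
              ((n + k).factorial : ℝ)⁻¹ * τ u else 0
      _ = _ := by
          rw [Finset.sum_comm]
          refine Finset.sum_congr rfl fun u _ => Finset.sum_congr rfl fun π _ => ?_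
          split_ifs <;> simp
  have hsum : ∑ y ∈ T, r y * (n.factorial * k.factorial) ≤ ∑ v : Fin (n + k) → X,
        τ v * (Finset.univ.filter fun π : Equiv.Perm (Fin (n + k)) =>
          (fun i => v (π (Fin.castAdd k i))) ∈ typeClass x).card := by
    -- Only the words `y ++ w` with `y ∈ T` are kept; each contributes at least `n! * k!`
    -- permutations.
    rw [sum_append]
    calc _ ≤ ∑ y ∈ T, ∑ z : Fin k → X, τ (Fin.append y z) *
          ((Finset.univ.filter fun π : Equiv.Perm (Fin (n + k)) =>
          (fun i => Fin.append y z (π (Fin.castAdd k i))) ∈ typeClass x).card : ℝ) := by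
          refine Finset.sum_le_sum fun y hy => ?_
          refine le_trans ?_ (Finset.single_le_sum (fun z _ => mul_nonneg (hτ _)
            (Nat.cast_nonneg _)) (Finset.mem_univ w))
          refine mul_le_mul (hrτ y hy) ?_ (by positivity) (hτ _)
          exact_mod_cast factorial_mul_le_card_perm x _ (hx y hy)
      _ ≤ _ := Finset.sum_le_sum_of_subset_of_nonneg (Finset.subset_univ _) fun y _ _ =>
          Finset.sum_nonneg fun z _ => mul_nonneg (hτ _) (Nat.cast_nonneg _)
  rw [← Finset.sum_mul] at hsum
  rw [hexp, ← mul_assoc]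
  have hfac : ((n + k).factorial : ℝ) = (n + k).choose n * (n.factorial * k.factorial) := by
    rw [← Nat.choose_mul_factorial_mul_factorial (Nat.le_add_right n k), Nat.add_sub_cancel_left]
    push_cast; ring
  have hch : ((n + k).choose n : ℝ) ≠ 0 := by
    exact_mod_cast (Nat.choose_pos (Nat.le_add_right n k)).ne'
  have hn0 : (n.factorial : ℝ) ≠ 0 := by exact_mod_cast n.factorial_ne_zero
  have hk0 : (k.factorial : ℝ) ≠ 0 := by exact_mod_cast k.factorial_ne_zero
  have hco : ((n + k).choose n : ℝ) * ((n + k).factorial : ℝ)⁻¹ =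
      (n.factorial * k.factorial : ℝ)⁻¹ := by
    rw [hfac]; field_simp
  rw [hco, ← div_eq_inv_mul, le_div_iff₀ (by positivity)]
  exact hsum

end Axioms

/-! ### Concentration of letter counts for i.i.d. words. -/

section Concentration

variable {X : Type*} [Fintype X]

/-- Hoeffding's lemma on a finite alphabet. -/
lemma sum_mul_exp_le {p : X → ℝ} (hp : p ∈ stdSimplex ℝ X) (f : X → ℝ)
    (hf : ∀ a, f a ∈ Set.Icc (0 : ℝ) 1) (t : ℝ) :
    ∑ a, p a * Real.exp (t * (f a - ∑ b, p b * f b)) ≤ Real.exp (t ^ 2 / 8) := by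
  let _ : MeasurableSpace X := ⊤
  let P : PMF X := PMF.ofFintype (fun a => ENNReal.ofReal (p a)) (by
    rw [← ENNReal.ofReal_sum_of_nonneg fun a _ => hp.1 a, hp.2, ENNReal.ofReal_one])
  have hint : ∀ h : X → ℝ, ∫ a, h a ∂P.toMeasure = ∑ a, p a * h a := fun h => by
    rw [PMF.integral_eq_sum]
    simp [P, ENNReal.toReal_ofReal (hp.1 _)]
  have h := (ProbabilityTheory.hasSubgaussianMGF_of_mem_Icc (μ := P.toMeasure) (X := f)
    (measurable_from_top).aemeasurable (Eventually.of_forall hf)).mgf_le t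
  rw [ProbabilityTheory.mgf, hint, hint] at h
  refine h.trans (Real.exp_le_exp.2 (le_of_eq ?_))
  norm_num
  ring

/-- Hoeffding's inequality for words with i.i.d. letters. -/
lemma sum_filter_iid_le {p : X → ℝ} (hp : p ∈ stdSimplex ℝ X) (f : X → ℝ)
    (hf : ∀ a, f a ∈ Set.Icc (0 : ℝ) 1) {n : ℕ} (hn : 1 ≤ n) {s : ℝ} (hs : 0 ≤ s) :
    ∑ x : Fin n → X with s < ∑ i, (f (x i) - ∑ b, p b * f b), iid p n x ≤
      Real.exp (-(2 * s ^ 2 / n)) := by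
  classical
  have hn' : (0 : ℝ) < n := by exact_mod_cast hn
  set μ := ∑ b, p b * f b
  -- The minimiser of the Chernoff exponent `n * t ^ 2 / 8 - t * s`.
  set t : ℝ := 4 * s / n
  have ht : 0 ≤ t := by positivity
  have hprod : ∑ x : Fin n → X, iid p n x * Real.exp (t * ∑ i, (f (x i) - μ)) =
      (∑ a, p a * Real.exp (t * (f a - μ))) ^ n := by
    have := Finset.prod_univ_sum (fun _ : Fin n => (Finset.univ : Finset X))
      fun _ a => p a * Real.exp (t * (f a - μ))
    simp only [Fintype.piFinset_univ, Finset.prod_const, Finset.card_univ, Fintype.card_fin,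
      Finset.prod_mul_distrib, ← Real.exp_sum, ← Finset.mul_sum] at this
    exact this.symm
  calc _ ≤ ∑ x : Fin n → X with s < ∑ i, (f (x i) - μ),
        iid p n x * Real.exp (t * ∑ i, (f (x i) - μ)) * Real.exp (-(t * s)) := by
        refine Finset.sum_le_sum fun x hx => ?_
        rw [mul_assoc, ← Real.exp_add]
        refine le_mul_of_one_le_right (iid_nonneg hp.1 x) (Real.one_le_exp ?_)
        have := mul_le_mul_of_nonneg_left (Finset.mem_filter.1 hx).2.le ht
        linarith
    _ ≤ ∑ x : Fin n → X, iid p n x * Real.exp (t * ∑ i, (f (x i) - μ)) * Real.exp (-(t * s)) :=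
        Finset.sum_le_sum_of_subset_of_nonneg (Finset.filter_subset _ _) fun x _ _ =>
          mul_nonneg (mul_nonneg (iid_nonneg hp.1 x) (Real.exp_nonneg _)) (Real.exp_nonneg _)
    _ = (∑ a, p a * Real.exp (t * (f a - μ))) ^ n * Real.exp (-(t * s)) := by
        rw [← Finset.sum_mul, hprod]
    _ ≤ Real.exp (t ^ 2 / 8) ^ n * Real.exp (-(t * s)) := by
        gcongr
        · exact Finset.sum_nonneg fun a _ => mul_nonneg (hp.1 a) (Real.exp_nonneg _)
        · exact sum_mul_exp_le hp f hf t
    _ = Real.exp (-(2 * s ^ 2 / n)) := by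
        rw [← Real.exp_nat_mul, ← Real.exp_add]
        congr 1
        simp only [t]
        field_simp
        ring

/-- Words of length `n` whose letter counts differ from their expectation by at most `s`. -/
def typicalSet [DecidableEq X] (p : X → ℝ) (n : ℕ) (s : ℝ) : Finset (Fin n → X) :=
  Finset.univ.filter fun x => ∀ a, |(letterCount x a : ℝ) - n * p a| ≤ s

lemma mem_typicalSet [DecidableEq X] {p : X → ℝ} {n : ℕ} {s : ℝ} {x : Fin n → X} :
    x ∈ typicalSet p n s ↔ ∀ a, |(letterCount x a : ℝ) - n * p a| ≤ s := by
  simp [typicalSet]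

/-- Union bound over the letters and the two signs of the deviation. The lower tail is the upper
tail of the complementary indicator `dn`. -/
lemma sum_compl_typicalSet_le [DecidableEq X] {p : X → ℝ} (hp : p ∈ stdSimplex ℝ X) {n : ℕ}
    (hn : 1 ≤ n) {s : ℝ} (hs : 0 ≤ s) :
    ∑ x ∈ (typicalSet p n s)ᶜ, iid p n x ≤
      2 * Fintype.card X * Real.exp (-(2 * s ^ 2 / n)) := by
  let up : X → X → ℝ := fun a b => if b = a then 1 else 0
  let dn : X → X → ℝ := fun a b => if b = a then 0 else 1
  have hup : ∀ a b, up a b ∈ Set.Icc (0 : ℝ) 1 := fun a b => by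
    simp only [up]; split_ifs <;> simp
  have hdn : ∀ a b, dn a b ∈ Set.Icc (0 : ℝ) 1 := fun a b => by
    simp only [dn]; split_ifs <;> simp
  have hmup : ∀ a, ∑ b, p b * up a b = p a := fun a => by simp [up]
  have hdu : ∀ a b, dn a b = 1 - up a b := fun a b => by
    simp only [up, dn]; split_ifs <;> simp
  have hmdn : ∀ a, ∑ b, p b * dn a b = 1 - p a := fun a => by
    simp only [hdu, mul_sub, mul_one, Finset.sum_sub_distrib, hmup, hp.2]
  have hcount : ∀ (x : Fin n → X) a, ∑ i, (up a (x i) - p a) = letterCount x a - n * p a := by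
    intro x a
    simp [up, letterCount]
  have hcount' : ∀ (x : Fin n → X) a, ∑ i, (dn a (x i) - (1 - p a)) =
      -(letterCount x a - n * p a) := by
    intro x a
    rw [← hcount, ← Finset.sum_neg_distrib]
    exact Finset.sum_congr rfl fun i _ => by rw [hdu]; ring
  have hb := fun a => sum_filter_iid_le hp (up a) (hup a) hn hs
  have hb' := fun a => sum_filter_iid_le hp (dn a) (hdn a) hn hs
  simp only [hmup, hmdn, hcount, hcount'] at hb hb'
  have h0 : ∀ x : Fin n → X, 0 ≤ iid p n x := iid_nonneg hp.1
  calc _ ≤ ∑ x ∈ (typicalSet p n s)ᶜ, ∑ a : X,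
        ((if s < (letterCount x a : ℝ) - n * p a then iid p n x else 0) +
          if s < -((letterCount x a : ℝ) - n * p a) then iid p n x else 0) := by
        refine Finset.sum_le_sum fun x hx => ?_
        rw [Finset.mem_compl, mem_typicalSet] at hx
        push Not at hx
        obtain ⟨a, ha⟩ := hx
        have hnn : ∀ P : Prop, ∀ [Decidable P], 0 ≤ if P then iid p n x else 0 := fun P _ => by
          split_ifs
          exacts [h0 x, le_rfl]
        refine le_trans ?_ (Finset.single_le_sum (fun b _ => add_nonneg (hnn _) (hnn _))
          (Finset.mem_univ a))
        rcases lt_abs.1 ha with h | h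
        · rw [if_pos h]; linarith [hnn (s < -((letterCount x a : ℝ) - n * p a))]
        · rw [if_pos h]; linarith [hnn (s < (letterCount x a : ℝ) - n * p a)]
    _ ≤ ∑ x, ∑ a : X, ((if s < (letterCount x a : ℝ) - n * p a then iid p n x else 0) +
          if s < -((letterCount x a : ℝ) - n * p a) then iid p n x else 0) :=
        Finset.sum_le_sum_of_subset_of_nonneg (Finset.subset_univ _) fun x _ _ =>
          Finset.sum_nonneg fun a _ => by
            have := h0 x
            split_ifs <;> linarith
    _ ≤ ∑ a : X, 2 * Real.exp (-(2 * s ^ 2 / n)) := by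
        rw [Finset.sum_comm]
        refine Finset.sum_le_sum fun a _ => ?_
        rw [Finset.sum_add_distrib, ← Finset.sum_filter, ← Finset.sum_filter]
        linarith [hb a, hb' a]
    _ = _ := by simp; ring

/-- The choice of `delta` makes the exponent `K * logb 2 ((n + 1) / η)`, so the exponential is at
most `(η / (n + 1)) ^ K ≤ η / 2 ^ K`, and `2 * K ≤ 2 ^ K` absorbs the union bound. -/
lemma two_mul_card_mul_exp_le {K n : ℕ} (hK : 1 ≤ K) (hn : 1 ≤ n) {η : ℝ} (h0 : 0 < η)
    (h1 : η < 1) :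
    2 * K * Real.exp (-(2 * (n * delta K n η) ^ 2 / n)) ≤ η := by
  have hn' : (1 : ℝ) ≤ n := by exact_mod_cast hn
  have hr : 1 ≤ (n + 1) / η := by rw [le_div_iff₀ h0]; linarith
  have hln : 0 ≤ Real.log ((n + 1) / η) := Real.log_nonneg hr
  have hlog : Real.log ((n + 1) / η) ≤ Real.logb 2 ((n + 1) / η) := by
    rw [Real.logb, le_div_iff₀ (Real.log_pos one_lt_two)]
    nlinarith [Real.log_two_lt_d9]
  have hsq : 2 * (n * delta K n η) ^ 2 / n = K * Real.logb 2 ((n + 1) / η) := by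
    rw [mul_pow, delta, Real.sq_sqrt (mul_nonneg (by positivity) (hln.trans hlog))]
    field_simp
  have hexp : Real.exp (-(2 * (n * delta K n η) ^ 2 / n)) ≤ (η / (n + 1)) ^ K := by
    have : (η / (n + 1)) ^ K = Real.exp (-(K * Real.log ((n + 1) / η))) := by
      rw [← mul_neg, Real.exp_nat_mul, ← Real.log_inv, Real.exp_log (by positivity), inv_div]
    rw [hsq, this]
    gcongr
  have hpow : (η / (n + 1)) ^ K ≤ η / 2 ^ K := by
    rw [div_pow]
    gcongr
    · exact pow_le_of_le_one h0.le h1.le (by omega)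
    · linarith
  have h2K : (2 * K : ℝ) ≤ 2 ^ K := by
    obtain ⟨j, rfl⟩ : ∃ j, K = j + 1 := ⟨K - 1, by omega⟩
    have : 2 * (j + 1) ≤ 2 ^ (j + 1) := by
      rw [pow_succ']; have := Nat.lt_two_pow_self (n := j); omega
    exact_mod_cast this
  calc _ ≤ 2 * K * (η / 2 ^ K) := by gcongr; exact hexp.trans hpow
    _ ≤ 2 ^ K * (η / 2 ^ K) := by gcongr
    _ = η := by field_simp

lemma one_sub_le_sum_typicalSet [DecidableEq X] {p : X → ℝ} (hp : p ∈ stdSimplex ℝ X) {n : ℕ}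
    (hn : 1 ≤ n) {η : ℝ} (h0 : 0 < η) (h1 : η < 1) :
    1 - η ≤ ∑ x ∈ typicalSet p n (n * delta (Fintype.card X) n η), iid p n x := by
  have hK : 1 ≤ Fintype.card X := by
    by_contra! h
    have := Fintype.card_eq_zero_iff.1 (Nat.lt_one_iff.1 h)
    simpa using hp.2
  have hs : 0 ≤ n * delta (Fintype.card X) n η := mul_nonneg n.cast_nonneg (Real.sqrt_nonneg _)
  have h := (sum_compl_typicalSet_le hp hn hs).trans (two_mul_card_mul_exp_le hK hn h0 h1)
  have := Finset.sum_add_sum_compl (typicalSet p n (n * delta (Fintype.card X) n η)) (iid p n)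
  rw [(iid_mem_stdSimplex hp n).2] at this
  linarith

end Concentration

/-! ### The function `g` and binomial coefficients. -/

section BosonicEntropy

lemma g_eq (x : ℝ) :
    g x = ((x + 1) * Real.log (x + 1) - x * Real.log x) / Real.log 2 := by
  simp only [g, Real.logb]; ring

lemma continuous_g : Continuous g := by
  have : g = fun x => ((x + 1) * Real.log (x + 1) - x * Real.log x) / Real.log 2 :=
    funext g_eq
  rw [this]
  exact ((Real.continuous_mul_log.comp (continuous_id.add continuous_const)).sub
    Real.continuous_mul_log).div_const _

lemma monotoneOn_g : MonotoneOn g (Set.Ici 0) := by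
  refine monotoneOn_of_deriv_nonneg (convex_Ici 0) continuous_g.continuousOn ?_ ?_
  all_goals
    rw [interior_Ici]
    intro x (hx : 0 < x)
    have h1 : HasDerivAt (fun y : ℝ => (y + 1) * Real.log (y + 1)) (Real.log (x + 1) + 1) x := by
      have := (Real.hasDerivAt_mul_log (x := x + 1) (by positivity)).comp x
        ((hasDerivAt_id x).add_const 1)
      simpa [Function.comp_def] using this
    have h2 := ((h1.sub (Real.hasDerivAt_mul_log hx.ne')).div_const (Real.log 2))
    have h3 : HasDerivAt g ((Real.log (x + 1) + 1 - (Real.log x + 1)) / Real.log 2) x :=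
      h2.congr_of_eventuallyEq (Filter.Eventually.of_forall g_eq)
  · exact h3.differentiableAt.differentiableWithinAt
  · rw [h3.deriv]
    refine div_nonneg ?_ (Real.log_nonneg one_le_two)
    have := Real.log_le_log hx (by linarith : x ≤ x + 1)
    linarith

@[simp] lemma g_zero : g 0 = 0 := by simp [g]

lemma g_nonneg {x : ℝ} (hx : 0 ≤ x) : 0 ≤ g x := by
  have := monotoneOn_g (Set.self_mem_Ici (a := (0 : ℝ))) (Set.mem_Ici.2 hx) hx
  simpa using this

/-- A single term of the binomial expansion of `(n + k) ^ (n + k)` is at most the whole; taking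
logarithms gives exactly `n * g (k / n)`. -/
lemma choose_le_two_rpow {n k : ℕ} (hn : 1 ≤ n) (hk : 1 ≤ k) :
    ((n + k).choose n : ℝ) ≤ 2 ^ (n * g (k / n)) := by
  have hn' : (0 : ℝ) < n := by exact_mod_cast hn
  have hk' : (0 : ℝ) < k := by exact_mod_cast hk
  have h : (n : ℝ) ^ n * k ^ k * (n + k).choose n ≤ (n + k : ℝ) ^ (n + k) := by
    rw [add_pow]
    have := Finset.single_le_sum (f := fun m : ℕ =>
      (n : ℝ) ^ m * (k : ℝ) ^ (n + k - m) * ((n + k).choose m : ℝ)) (s := Finset.range (n + k + 1))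
      (fun _ _ => by positivity) (Finset.mem_range.2 (by omega : n < n + k + 1))
    simpa using this
  have hch : (0 : ℝ) < (n + k).choose n := by
    exact_mod_cast Nat.choose_pos (Nat.le_add_right n k)
  have hl := Real.log_le_log (by positivity) h
  rw [Real.log_mul (by positivity) hch.ne', Real.log_mul (by positivity) (by positivity),
    Real.log_pow, Real.log_pow, Real.log_pow] at hl
  rw [← Real.logb_le_iff_le_rpow one_lt_two hch, Real.logb, g_eq, mul_div_assoc']
  refine div_le_div_of_nonneg_right ?_ (Real.log_nonneg one_le_two)
  have h1 : (k / n + 1 : ℝ) = (n + k) / n := by field_simp; ring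
  rw [h1, Real.log_div (by positivity) hn'.ne', Real.log_div hk'.ne' hn'.ne']
  push_cast at hl
  have : (n : ℝ) * ((n + k) / n * (Real.log (n + k) - Real.log n) -
      k / n * (Real.log k - Real.log n)) = (n + k) * Real.log (n + k) - n * Real.log n -
      k * Real.log k := by
    field_simp; ring
  linarith

end BosonicEntropy

/-! ### Smoothing, and comparison of the divergences for a single pair of distributions. -/

section Smoothing

lemma toSet_le {Ω : Type*} {D : (Ω → ℝ) → (Ω → ℝ) → EReal}
    {p q : Ω → ℝ} {S : Set (Ω → ℝ)} (hq : q ∈ S) :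
    toSet D p S ≤ D p q :=
  iInf₂_le q hq

variable {Ω : Type*} [Fintype Ω]

lemma sum_mul_sub_sum_mul_le_tvDist {p p' : Ω → ℝ} (hp : p ∈ stdSimplex ℝ Ω)
    (hp' : p' ∈ stdSimplex ℝ Ω) {Q : Ω → ℝ} (hQ : ∀ x, 0 ≤ Q x ∧ Q x ≤ 1) :
    ∑ x, Q x * p x - ∑ x, Q x * p' x ≤ tvDist p p' := by
  -- Equal total masses allow centring `Q` at `1 / 2`; then `|Q - 1/2| ≤ 1/2` supplies the factor in
  -- `tvDist`.
  have h : ∑ x, Q x * p x - ∑ x, Q x * p' x = ∑ x, (Q x - 1 / 2) * (p x - p' x) := by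
    have : ∑ x, (Q x - 1 / 2) * (p x - p' x) =
        ∑ x, (Q x * p x - Q x * p' x - (1 / 2) * p x + (1 / 2) * p' x) :=
      Finset.sum_congr rfl fun x _ => by ring
    rw [this, Finset.sum_add_distrib, Finset.sum_sub_distrib, Finset.sum_sub_distrib,
      ← Finset.mul_sum, ← Finset.mul_sum, hp.2, hp'.2]
    ring
  rw [h, tvDist, Finset.mul_sum]
  refine Finset.sum_le_sum fun x _ => ?_
  calc _ ≤ |(Q x - 1 / 2) * (p x - p' x)| := le_abs_self _
    _ = |Q x - 1 / 2| * |p x - p' x| := abs_mul _ _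
    _ ≤ _ := by
      gcongr
      rw [abs_le]
      constructor <;> linarith [(hQ x).1, (hQ x).2]

/-- Conditioning `p` on a set `T` of probability at least `1 - η` is an admissible smoothing. -/
lemma dMaxSmooth_le_of_forall_mem [DecidableEq Ω] {p q : Ω → ℝ} (hp : p ∈ stdSimplex ℝ Ω)
    (hq : ∀ x, 0 ≤ q x) {T : Finset Ω} {η l : ℝ} (h0 : 0 < ∑ x ∈ T, p x)
    (h1 : 1 - η ≤ ∑ x ∈ T, p x) (hl : ∀ x ∈ T, p x ≤ (∑ x ∈ T, p x) * 2 ^ l * q x) :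
    dMaxSmooth η p q ≤ l := by
  set P := ∑ x ∈ T, p x
  have hP1 : P ≤ 1 := by
    rw [← hp.2]
    exact Finset.sum_le_sum_of_subset_of_nonneg (Finset.subset_univ _) fun x _ _ => hp.1 x
  have hcompl : ∑ x ∈ Tᶜ, p x = 1 - P := by
    rw [← hp.2, ← Finset.sum_add_sum_compl T p]; ring
  let p' : Ω → ℝ := fun x => if x ∈ T then p x / P else 0
  have hT : ∀ x ∈ T, p' x = p x / P := fun x hx => if_pos hx
  have hTc : ∀ x ∈ Tᶜ, p' x = 0 := fun x hx => if_neg (Finset.mem_compl.1 hx)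
  have hp' : p' ∈ stdSimplex ℝ Ω := by
    refine ⟨fun x => ?_, ?_⟩
    · simp only [p']; split_ifs
      exacts [div_nonneg (hp.1 x) h0.le, le_rfl]
    · rw [← Finset.sum_add_sum_compl T, Finset.sum_congr rfl hT, Finset.sum_congr rfl hTc,
        ← Finset.sum_div, Finset.sum_const_zero, add_zero]
      exact div_self h0.ne'
  have htv : tvDist p p' ≤ η := by
    have hA : ∑ x ∈ T, |p x - p' x| = 1 - P := by
      have : ∀ x ∈ T, |p x - p' x| = p x / P - p x := fun x hx => by
        rw [hT x hx, abs_sub_comm, abs_of_nonneg]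
        rw [sub_nonneg, le_div_iff₀ h0]
        exact mul_le_of_le_one_right (hp.1 x) hP1
      rw [Finset.sum_congr rfl this, Finset.sum_sub_distrib, ← Finset.sum_div]
      change P / P - P = 1 - P
      rw [div_self h0.ne']
    have hB : ∑ x ∈ Tᶜ, |p x - p' x| = 1 - P := by
      rw [← hcompl]
      exact Finset.sum_congr rfl fun x hx => by rw [hTc x hx, sub_zero, abs_of_nonneg (hp.1 x)]
    rw [tvDist, ← Finset.sum_add_sum_compl T, hA, hB]
    linarith
  refine (iInf₂_le p' ⟨hp', htv⟩).trans (sInf_le ⟨l, fun x => ?_, rfl⟩)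
  by_cases hx : x ∈ T
  · rw [hT x hx, div_le_iff₀ h0]
    linarith [hl x hx]
  · rw [hTc x (Finset.mem_compl.2 hx)]
    exact mul_nonneg (by positivity) (hq x)

lemma le_toSet_dMaxSmooth {A : EReal} {ε : ℝ} {p : Ω → ℝ} {S : Set (Ω → ℝ)}
    (h : ∀ q ∈ S, ∀ p' ∈ stdSimplex ℝ Ω, tvDist p p' ≤ ε → ∀ l : ℝ,
      (∀ x, p' x ≤ 2 ^ l * q x) → A ≤ l) : A ≤ toSet (dMaxSmooth ε) p S := by
  refine le_iInf₂ fun q hq => le_iInf₂ fun p' hp' => le_sInf ?_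
  rintro _ ⟨l, hl, rfl⟩
  exact h q hq p' hp'.1 hp'.2 l hl

lemma dMaxSmooth_anti {ε ε' : ℝ} (h : ε ≤ ε') (p : Ω → ℝ) (S : Set (Ω → ℝ)) :
    toSet (dMaxSmooth ε') p S ≤ toSet (dMaxSmooth ε) p S :=
  iInf₂_mono fun _ _ => biInf_mono fun _ hp' => ⟨hp'.1, hp'.2.trans h⟩

lemma le_add_coe_of_sub_coe_le {a b : EReal} {r : ℝ} (h : a - r ≤ b) : a ≤ b + r :=
  (EReal.sub_le_iff_le_add (.inl (EReal.coe_ne_bot r)) (.inl (EReal.coe_ne_top r))).1 h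

lemma sub_coe_le_of_le_add_coe {a b : EReal} {r : ℝ} (h : a ≤ b + r) : a - r ≤ b :=
  (EReal.sub_le_iff_le_add (.inl (EReal.coe_ne_bot r)) (.inl (EReal.coe_ne_top r))).2 h

/-- Markov's inequality bounds the smooth max-relative entropy by the relative entropy. -/
lemma dMaxSmooth_le_of_relEnt {p q : Ω → ℝ} (hp : p ∈ stdSimplex ℝ Ω) (hq : q ∈ stdSimplex ℝ Ω)
    (hpq : ∀ x, q x = 0 → p x = 0) {θ : ℝ} (h0 : 0 < θ) (h1 : θ < 1) :
    dMaxSmooth θ p q ≤ (((∑ x, p x * Real.logb 2 (p x / q x)) + 3) / θ +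
      Real.logb 2 (1 / (1 - θ)) : ℝ) := by
  classical
  set D := ∑ x, p x * Real.logb 2 (p x / q x)
  -- Markov's inequality needs a nonnegative variable. Passing to the positive part costs at most `q
  -- x / log 2 ≤ 2 * q x` at each point, by `log t ≤ t - 1`.
  have hpos : ∀ x, p x * max (Real.logb 2 (p x / q x)) 0 ≤
      p x * Real.logb 2 (p x / q x) + 2 * q x := by
    intro x
    rcases (hp.1 x).eq_or_lt with hx | hx
    · simp only [← hx, zero_mul, zero_add]
      linarith [hq.1 x]
    have hqx : 0 < q x := (hq.1 x).lt_of_ne fun h => hx.ne' (hpq x h.symm)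
    rcases le_total 0 (Real.logb 2 (p x / q x)) with h | h
    · rw [max_eq_left h]; linarith
    rw [max_eq_right h, mul_zero]
    have hlog : Real.log (q x / p x) ≤ q x / p x - 1 := Real.log_le_sub_one_of_pos (by positivity)
    have h2 : p x * Real.log (q x / p x) ≤ q x := by
      have := mul_le_mul_of_nonneg_left hlog hx.le
      have h3 : p x * (q x / p x - 1) = q x - p x := by field_simp
      linarith
    have h4 : Real.logb 2 (p x / q x) = -(Real.log (q x / p x) / Real.log 2) := by
      rw [← inv_div, Real.logb_inv, Real.logb]
    have h5 : p x * (Real.log (q x / p x) / Real.log 2) ≤ 2 * q x := by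
      rw [← mul_div_assoc, div_le_iff₀ (Real.log_pos one_lt_two)]
      nlinarith [Real.log_two_gt_d9]
    rw [h4]
    linarith
  have hE : ∑ x, p x * max (Real.logb 2 (p x / q x)) 0 ≤ D + 2 := by
    refine (Finset.sum_le_sum fun x _ => hpos x).trans ?_
    rw [Finset.sum_add_distrib, ← Finset.mul_sum, hq.2]
    linarith
  have hE0 : 0 ≤ ∑ x, p x * max (Real.logb 2 (p x / q x)) 0 :=
    Finset.sum_nonneg fun x _ => mul_nonneg (hp.1 x) (le_max_right _ _)
  -- The expectation is at most `D + 2`; the extra `1` makes `B` strictly positive, so that it can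
  -- be cancelled.
  set B := D + 3
  have hB : 0 < B := by simp only [B]; linarith
  let T : Finset Ω := Finset.univ.filter fun x => Real.logb 2 (p x / q x) ≤ B / θ
  have hTc : ∑ x ∈ Tᶜ, p x ≤ θ := by
    have hm : (∑ x ∈ Tᶜ, p x) * (B / θ) ≤ B := by
      calc _ = ∑ x ∈ Tᶜ, p x * (B / θ) := Finset.sum_mul _ _ _
        _ ≤ ∑ x ∈ Tᶜ, p x * max (Real.logb 2 (p x / q x)) 0 := by
          refine Finset.sum_le_sum fun x hx => mul_le_mul_of_nonneg_left ?_ (hp.1 x)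
          have : B / θ < Real.logb 2 (p x / q x) := by simpa [T] using hx
          exact this.le.trans (le_max_left _ _)
        _ ≤ ∑ x, p x * max (Real.logb 2 (p x / q x)) 0 :=
          Finset.sum_le_sum_of_subset_of_nonneg (Finset.subset_univ _) fun x _ _ =>
            mul_nonneg (hp.1 x) (le_max_right _ _)
        _ ≤ B := by simp only [B]; linarith
    rwa [← mul_div_assoc, div_le_iff₀ h0, mul_comm, mul_le_mul_iff_right₀ hB] at hm
  have hT : 1 - θ ≤ ∑ x ∈ T, p x := by
    have := Finset.sum_add_sum_compl T p
    rw [hp.2] at this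
    linarith
  refine dMaxSmooth_le_of_forall_mem hp hq.1 (by linarith) hT fun x hx => ?_
  have hθ : 0 < 1 - θ := by linarith
  rw [Real.rpow_add two_pos, Real.rpow_logb two_pos (by norm_num) (by positivity)]
  have hxl : p x ≤ 2 ^ (B / θ) * q x := by
    rcases (hp.1 x).eq_or_lt with hx' | hx'
    · rw [← hx']; exact mul_nonneg (by positivity) (hq.1 x)
    have hqx : 0 < q x := (hq.1 x).lt_of_ne fun h => hx'.ne' (hpq x h.symm)
    have : Real.logb 2 (p x / q x) ≤ B / θ := by simpa [T] using hx
    rwa [Real.logb_le_iff_le_rpow one_lt_two (by positivity), div_le_iff₀ hqx] at this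
  calc p x ≤ 1 * (2 ^ (B / θ) * q x) := by rwa [one_mul]
    _ ≤ ((∑ x ∈ T, p x) * (1 / (1 - θ))) * (2 ^ (B / θ) * q x) := by
      refine mul_le_mul_of_nonneg_right ?_ (mul_nonneg (by positivity) (hq.1 x))
      rw [mul_one_div, le_div_iff₀ hθ]; linarith
    _ = _ := by ring

lemma le_negLog {t l : ℝ} (h0 : 0 ≤ t) (h : t ≤ 2 ^ (-l)) : (l : EReal) ≤ negLog t := by
  rw [negLog]
  split_ifs with ht
  · exact le_top
  · have ht' : 0 < t := h0.lt_of_ne' ht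
    rw [EReal.coe_le_coe_iff]
    rw [← Real.logb_le_iff_le_rpow one_lt_two ht'] at h
    linarith

lemma negLog_le {t l : ℝ} (h : (2 : ℝ) ^ (-l) ≤ t) : negLog t ≤ l := by
  have ht : 0 < t := lt_of_lt_of_le (by positivity) h
  rw [negLog, if_neg ht.ne', EReal.coe_le_coe_iff]
  rw [← Real.le_logb_iff_rpow_le one_lt_two ht] at h
  linarith

/-- A test accepting `p` with probability `1 - ε` accepts `p'` with probability at least `1 - ε -
η`, hence `q` with at least `2 ^ (-l)` times that. -/
lemma dHyp_le_of_forall_le {p p' q : Ω → ℝ} (hp : p ∈ stdSimplex ℝ Ω) (hp' : p' ∈ stdSimplex ℝ Ω)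
    {ε η l : ℝ} (hε : 0 ≤ ε) (hεη : ε + η < 1) (htv : tvDist p p' ≤ η)
    (hl : ∀ x, p' x ≤ 2 ^ l * q x) :
    dHyp ε p q ≤ (l + Real.logb 2 (1 / (1 - ε - η)) : ℝ) := by
  have hpos : 0 < 1 - ε - η := by linarith
  refine negLog_le (le_csInf ⟨_, fun _ => 1, by simp, by simp [hp.2, hε], rfl⟩ ?_)
  rintro _ ⟨Q, hQ, hQp, rfl⟩
  have h1 := sum_mul_sub_sum_mul_le_tvDist hp hp' hQ
  have h2 : ∑ x, Q x * p' x ≤ 2 ^ l * ∑ x, Q x * q x := by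
    rw [Finset.mul_sum]
    refine Finset.sum_le_sum fun x _ => ?_
    have := mul_le_mul_of_nonneg_left (hl x) (hQ x).1
    linarith
  rw [one_div, Real.logb_inv, neg_add, neg_neg, Real.rpow_add two_pos,
    Real.rpow_logb two_pos (by norm_num) hpos, Real.rpow_neg two_pos.le, ← div_eq_inv_mul,
    div_le_iff₀ (by positivity)]
  linarith

/-- A Neyman–Pearson dichotomy for a threshold `l` strictly between the two sides. If `T = {p ≤ 2 ^
l * q}` has mass at least `ε`, conditioning on it is a `(1 - ε)`-smoothing; otherwise the indicator
of `Tᶜ` is a test with type-II error at most `2 ^ (-l)`. Either case contradicts the choice of `l`.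
-/
lemma dMaxSmooth_sub_le_dHyp {p q : Ω → ℝ} (hp : p ∈ stdSimplex ℝ Ω) (hq : ∀ x, 0 ≤ q x)
    {ε : ℝ} (h0 : 0 < ε) :
    dMaxSmooth (1 - ε) p q - (Real.logb 2 (1 / ε) : ℝ) ≤ dHyp ε p q := by
  classical
  by_contra! hlt
  obtain ⟨l, hl1, hl2⟩ := EReal.lt_iff_exists_real_btwn.1 hlt
  let T : Finset Ω := Finset.univ.filter fun x => p x ≤ 2 ^ l * q x
  rcases le_or_gt ε (∑ x ∈ T, p x) with h | h
  · refine hl2.not_ge (sub_coe_le_of_le_add_coe ?_)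
    rw [← EReal.coe_add]
    refine dMaxSmooth_le_of_forall_mem hp hq (h0.trans_le h) (by linarith) fun x hx => ?_
    have hx' : p x ≤ 2 ^ l * q x := by simpa [T] using hx
    rw [Real.rpow_add two_pos, Real.rpow_logb two_pos (by norm_num) (by positivity)]
    calc p x ≤ 1 * (2 ^ l * q x) := by rwa [one_mul]
      _ ≤ ((∑ x ∈ T, p x) * (1 / ε)) * (2 ^ l * q x) := by
        refine mul_le_mul_of_nonneg_right ?_ (mul_nonneg (by positivity) (hq x))
        rw [mul_one_div, le_div_iff₀ h0]; linarith
      _ = _ := by ring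
  · refine hl1.not_ge (le_negLog (Real.sInf_nonneg ?_) ?_)
    · rintro _ ⟨Q, hQ, -, rfl⟩
      exact Finset.sum_nonneg fun x _ => mul_nonneg (hQ x).1 (hq x)
    · have hcompl := Finset.sum_add_sum_compl T p
      rw [hp.2] at hcompl
      have hb : BddBelow {t : ℝ | ∃ Q : Ω → ℝ, (∀ x, 0 ≤ Q x ∧ Q x ≤ 1) ∧
          1 - ε ≤ ∑ x, Q x * p x ∧ t = ∑ x, Q x * q x} := by
        refine ⟨0, ?_⟩
        rintro _ ⟨Q, hQ, -, rfl⟩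
        exact Finset.sum_nonneg fun x _ => mul_nonneg (hQ x).1 (hq x)
      refine (csInf_le hb ⟨fun x => if x ∈ Tᶜ then 1 else 0, fun x => ?_, ?_, rfl⟩).trans ?_
      · beta_reduce
        split_ifs <;> simp
      · simp only [ite_mul, one_mul, zero_mul, Finset.sum_ite_mem, Finset.univ_inter]
        linarith
      · simp only [ite_mul, one_mul, zero_mul, Finset.sum_ite_mem, Finset.univ_inter]
        rw [Real.rpow_neg two_pos.le, ← one_div, le_div_iff₀ (by positivity), Finset.sum_mul]
        calc _ ≤ ∑ x ∈ Tᶜ, p x := by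
              refine Finset.sum_le_sum fun x hx => ?_
              have : 2 ^ l * q x < p x := by simpa [T] using hx
              linarith
          _ ≤ 1 := by
              have : 0 ≤ ∑ x ∈ T, p x := Finset.sum_nonneg fun x _ => hp.1 x
              linarith

end Smoothing

/-! ### The one-shot bounds. -/

section OneShot

variable {X : Type*} [Fintype X] {F : (n : ℕ) → Set ((Fin n → X) → ℝ)} {c : ℝ}

/-- The additive cost of changing the smoothing parameter from `ε` to `η`. -/
def blurCost (K : ℕ) (c : ℝ) (n : ℕ) (η ε : ℝ) : ℝ :=
  Real.logb 2 (1 / (1 - ε - η)) + 2 * n * g ((2 * delta K n η + 1 / n) * K)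
    + (2 * n * delta K n η + 1) * K * Real.logb 2 (1 / c)

lemma BrandaoPlenio.logb_one_div_nonneg (hF : BrandaoPlenio F c) : 0 ≤ Real.logb 2 (1 / c) := by
  obtain ⟨q, hq, hc⟩ := hF.full_support
  have hq' := hF.subset_simplex 1 le_rfl hq
  have hne : Nonempty (Fin 1 → X) := by
    by_contra h
    rw [not_nonempty_iff] at h
    simpa using hq'.2
  obtain ⟨x⟩ := hne
  have hc1 : c ≤ 1 := (hc x).trans (by
    rw [← hq'.2]
    exact Finset.single_le_sum (fun y _ => hq'.1 y) (Finset.mem_univ x))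
  refine Real.logb_nonneg one_lt_two ?_
  rwa [le_div_iff₀ hF.c_pos, one_mul]

lemma delta_pos {K n : ℕ} (hK : 1 ≤ K) (hn : 1 ≤ n) {η : ℝ} (h0 : 0 < η) (h1 : η < 1) :
    0 < delta K n η := by
  have hn' : (1 : ℝ) ≤ n := by exact_mod_cast hn
  have hK' : (0 : ℝ) < K := by exact_mod_cast hK
  refine Real.sqrt_pos.2 (mul_pos (by positivity) (Real.logb_pos one_lt_two ?_))
  rw [lt_div_iff₀ h0]
  linarith

/-- The blurred distribution serves as `σ`. Keeping the mass of the typical set as a factor cancels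
the normalisation when `p^{⊗ n}` is conditioned on that set, so no further loss arises there. -/
lemma exists_mem_forall_typicalSet_le [DecidableEq X] (hF : BrandaoPlenio F c) {p : X → ℝ}
    (hp : p ∈ stdSimplex ℝ X) {n : ℕ} (hn : 1 ≤ n) {η ε : ℝ} (hη0 : 0 < η) (hη1 : η < 1)
    (hηε : η + ε < 1) {q p' : (Fin n → X) → ℝ} (hq : q ∈ F n)
    (hp' : p' ∈ stdSimplex ℝ (Fin n → X)) (htv : tvDist (iid p n) p' ≤ ε) {l : ℝ}
    (hl : ∀ x, p' x ≤ 2 ^ l * q x) :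
    ∃ σ ∈ F n, ∀ x ∈ typicalSet p n (n * delta (Fintype.card X) n η),
      iid p n x ≤ (∑ y ∈ typicalSet p n (n * delta (Fintype.card X) n η), iid p n y) *
        2 ^ (l + blurCost (Fintype.card X) c n η ε) * σ x := by
  set K := Fintype.card X
  have hK : 1 ≤ K := by
    by_contra! h
    have := Fintype.card_eq_zero_iff.1 (Nat.lt_one_iff.1 h)
    simpa using hp.2
  have hn' : (0 : ℝ) < n := by exact_mod_cast hn
  have hK' : (0 : ℝ) < K := by exact_mod_cast hK
  have hδ := delta_pos hK hn hη0 hη1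
  set δ := delta K n η
  set T := typicalSet p n (n * δ)
  have hc := hF.c_pos
  have hqs := hF.subset_simplex n hn hq
  obtain ⟨q₀, hq₀, hq₀F⟩ := hF.exists_iid_mem
  -- Letter counts of two typical words differ by at most `2 * n * δ`, so `m` spare copies of each
  -- letter suffice. Also `m ≥ 1`, hence `k ≥ 1`, as the tensor axiom requires.
  set m := ⌈2 * (n * δ)⌉₊
  have hm1 : 1 ≤ m := Nat.one_le_iff_ne_zero.2 (Nat.ceil_pos.2 (by positivity)).ne'
  have hmle : (m : ℝ) ≤ 2 * n * δ + 1 := by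
    have := (Nat.ceil_lt_add_one (by positivity : 0 ≤ 2 * (n * δ))).le
    linarith
  obtain ⟨k, hk, w, hw⟩ : ∃ k, k = m * K ∧ ∃ w : Fin k → X, ∀ a, letterCount w a = m :=
    ⟨_, rfl, exists_word_letterCount_eq m⟩
  have hk1 : 1 ≤ k := hk ▸ Nat.mul_pos hm1 hK
  have hτF : tensor q (iid q₀ k) ∈ F (n + k) :=
    hF.tensor_mem n k hn hk1 q hq _ (hq₀F k hk1)
  have hσF : prefixMarginal k (permAverage (tensor q (iid q₀ k))) ∈ F n :=
    hF.prefixMarginal_mem hn k _ (hF.permAverage_mem (by omega) _ hτF)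
  set σ := prefixMarginal k (permAverage (tensor q (iid q₀ k))) with hσ
  refine ⟨σ, hσF, fun x hx => ?_⟩
  have hblur : ∑ y ∈ T, q y * c ^ k ≤ (n + k).choose n * ∑ x' ∈ typeClass x, σ x' := by
    refine sum_le_choose_mul_sum_typeClass _ (hF.subset_simplex _ (by omega) hτF).1 _ w T
      (fun y _ => ?_) x fun y hy => exists_perm_prefix x _ fun a => ?_
    · rw [tensor_append]
      exact mul_le_mul_of_nonneg_left (pow_le_iid hc.le hq₀ w) (hqs.1 y)
    · rw [letterCount_append, hw]
      have h1 := (abs_le.1 (mem_typicalSet.1 hx a)).2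
      have h2 := (abs_le.1 (mem_typicalSet.1 hy a)).1
      have h3 : 2 * (n * δ) ≤ m := Nat.le_ceil _
      have : (letterCount x a : ℝ) ≤ letterCount y a + m := by linarith
      exact_mod_cast this
  rw [sum_typeClass (prefixMarginal_permAverage_comp_perm _), ← hσ] at hblur
  have hTp := one_sub_le_sum_typicalSet hp hn hη0 hη1
  have hclass : ((typeClass x).card : ℝ) * iid p n x ≤ ∑ y ∈ T, iid p n y := by
    rw [← sum_typeClass (iid_comp_perm p)]
    refine Finset.sum_le_sum_of_subset_of_nonneg (fun x' hx' => ?_) fun y _ _ => iid_nonneg hp.1 y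
    obtain ⟨α, rfl⟩ := (Finset.mem_filter.1 hx').2
    simp only [T, mem_typicalSet, letterCount_comp_perm]
    exact mem_typicalSet.1 hx
  -- The indicator of `T` is used as a test: `p'` gives `T` at least the mass under `p^{⊗ n}` minus
  -- `ε`.
  have hqT : 1 - ε - η ≤ 2 ^ l * ∑ y ∈ T, q y := by
    have h1 := sum_mul_sub_sum_mul_le_tvDist (iid_mem_stdSimplex hp n) hp'
      (Q := fun y => if y ∈ T then 1 else 0) (fun y => by split_ifs <;> simp)
    simp only [ite_mul, one_mul, zero_mul, Finset.sum_ite_mem, Finset.univ_inter] at h1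
    have h2 : ∑ y ∈ T, p' y ≤ 2 ^ l * ∑ y ∈ T, q y := by
      rw [Finset.mul_sum]
      exact Finset.sum_le_sum fun y _ => hl y
    change 1 - η ≤ ∑ y ∈ T, iid p n y at hTp
    linarith
  have hpos : 0 < 1 - ε - η := by linarith
  have hL := hF.logb_one_div_nonneg
  -- The exponent `n * g` would already suffice; the factor `2` is slack.
  have hchoose : ((n + k).choose n : ℝ) ≤ 2 ^ (2 * n * g ((2 * δ + 1 / n) * K)) := by
    refine (choose_le_two_rpow hn hk1).trans (Real.rpow_le_rpow_of_exponent_le one_le_two ?_)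
    have hkn : (k / n : ℝ) ≤ (2 * δ + 1 / n) * K := by
      have : (k : ℝ) = m * K := by rw [hk]; push_cast; ring
      rw [this, div_le_iff₀ hn']
      have h3 : (2 * δ + 1 / n) * K * n = (2 * n * δ + 1) * K := by field_simp
      rw [h3]
      gcongr
    have hmono := monotoneOn_g (Set.mem_Ici.2 (by positivity)) (Set.mem_Ici.2 (by positivity)) hkn
    have hg := g_nonneg (x := (2 * δ + 1 / n) * K) (by positivity)
    nlinarith
  have hcpow : (c ^ k)⁻¹ ≤ (2 : ℝ) ^ ((2 * n * δ + 1) * K * Real.logb 2 (1 / c)) := by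
    have h1 : (c ^ k)⁻¹ = (2 : ℝ) ^ (k * Real.logb 2 (1 / c)) := by
      rw [mul_comm, Real.rpow_mul two_pos.le, Real.rpow_logb two_pos (by norm_num)
        (by positivity), Real.rpow_natCast, one_div, inv_pow]
    rw [h1]
    refine Real.rpow_le_rpow_of_exponent_le one_le_two (mul_le_mul_of_nonneg_right ?_ hL)
    rw [hk]; push_cast
    gcongr
  have hcost : (2 : ℝ) ^ l * (1 / (1 - ε - η)) * (n + k).choose n * (c ^ k)⁻¹ ≤
      2 ^ (l + blurCost K c n η ε) := by
    rw [blurCost, Real.rpow_add two_pos, Real.rpow_add two_pos, Real.rpow_add two_pos,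
      Real.rpow_logb two_pos (by norm_num) (by positivity), ← mul_assoc, ← mul_assoc]
    gcongr
  have hσ0 : 0 ≤ σ x := (hF.subset_simplex n hn hσF).1 x
  have hP0 : 0 ≤ ∑ y ∈ T, iid p n y := Finset.sum_nonneg fun y _ => iid_nonneg hp.1 y
  have hcard : (0 : ℝ) < (typeClass x).card := by
    exact_mod_cast Finset.card_pos.2 ⟨x, mem_typeClass_self x⟩
  rw [← Finset.sum_mul] at hblur
  have hkey : (1 : ℝ) ≤ (2 ^ l * (1 / (1 - ε - η)) * (n + k).choose n * (c ^ k)⁻¹) *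
      ((typeClass x).card * σ x) := by
    have e1 : (2 ^ l * (1 / (1 - ε - η)) * (n + k).choose n * (c ^ k)⁻¹) *
      ((typeClass x).card * σ x) =
      (2 ^ l * ((n + k).choose n * ((typeClass x).card * σ x))) / ((1 - ε - η) * c ^ k) := by
      field_simp
    rw [e1, le_div_iff₀ (by positivity), one_mul]
    calc (1 - ε - η) * c ^ k ≤ 2 ^ l * (∑ y ∈ T, q y) * c ^ k := by gcongr
      _ = 2 ^ l * ((∑ y ∈ T, q y) * c ^ k) := by ring
      _ ≤ _ := by gcongr
  have hkey' : (1 : ℝ) ≤ 2 ^ (l + blurCost K c n η ε) * ((typeClass x).card * σ x) :=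
    hkey.trans (mul_le_mul_of_nonneg_right hcost (by positivity))
  have := mul_le_mul_of_nonneg_left hkey' hP0
  rw [← mul_le_mul_iff_right₀ hcard]
  calc _ ≤ _ := hclass
    _ = (∑ y ∈ T, iid p n y) * 1 := (mul_one _).symm
    _ ≤ _ := this
    _ = _ := by ring

/-- One-shot bound: changing the smoothing parameter costs at most `blurCost`. -/
lemma toSet_dMaxSmooth_le (hF : BrandaoPlenio F c) {p : X → ℝ}
    (hp : p ∈ stdSimplex ℝ X) {n : ℕ} (hn : 1 ≤ n) {η ε : ℝ} (hη0 : 0 < η) (hη1 : η < 1)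
    (hηε : η + ε < 1) :
    toSet (dMaxSmooth η) (iid p n) (F n) ≤ toSet (dMaxSmooth ε) (iid p n) (F n) +
      (blurCost (Fintype.card X) c n η ε : ℝ) := by
  classical
  refine le_add_coe_of_sub_coe_le (le_toSet_dMaxSmooth fun q hq p' hp' htv l hl => ?_)
  obtain ⟨σ, hσ, h⟩ := exists_mem_forall_typicalSet_le hF hp hn hη0 hη1 hηε hq hp' htv hl
  refine sub_coe_le_of_le_add_coe ((toSet_le hσ).trans ?_)
  have hT := one_sub_le_sum_typicalSet hp hn hη0 hη1
  rw [← EReal.coe_add]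
  exact dMaxSmooth_le_of_forall_mem (iid_mem_stdSimplex hp n) (hF.subset_simplex n hn hσ).1
    (by linarith) hT h

lemma mul_logb_div_le {a b l : ℝ} (ha : 0 ≤ a) (hb : 0 < b) (h : a ≤ 2 ^ l * b) :
    a * Real.logb 2 (a / b) ≤ a * l := by
  rcases ha.eq_or_lt with rfl | ha'
  · simp
  refine mul_le_mul_of_nonneg_left ?_ ha
  rwa [Real.logb_le_iff_le_rpow one_lt_two (by positivity), div_le_iff₀ hb]

lemma two_rpow_mul_pow_eq_one (hc : 0 < c) (n : ℕ) :
    (2 : ℝ) ^ (n * Real.logb 2 (1 / c)) * c ^ n = 1 := by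
  rw [mul_comm (n : ℝ), Real.rpow_mul two_pos.le, Real.rpow_logb two_pos (by norm_num)
    (by positivity), Real.rpow_natCast, ← mul_pow, one_div_mul_cancel hc.ne', one_pow]

lemma iid_le_one {p : X → ℝ} (hp : p ∈ stdSimplex ℝ X) {n : ℕ} (x : Fin n → X) :
    iid p n x ≤ 1 := by
  rw [← (iid_mem_stdSimplex hp n).2]
  exact Finset.single_le_sum (fun y _ => iid_nonneg hp.1 y) (Finset.mem_univ x)

/-- The relative entropy is bounded by the smooth max-relative entropy. -/
lemma toSet_relEnt_le (hF : BrandaoPlenio F c) {p : X → ℝ}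
    (hp : p ∈ stdSimplex ℝ X) {n : ℕ} (hn : 1 ≤ n) {η ε : ℝ} (hη0 : 0 < η) (hη1 : η < 1)
    (hηε : η + ε < 1) :
    toSet relEnt (iid p n) (F n) ≤ toSet (dMaxSmooth ε) (iid p n) (F n) +
      (blurCost (Fintype.card X) c n η ε + 1 + η * (n * Real.logb 2 (1 / c)) : ℝ) := by
  classical
  refine le_add_coe_of_sub_coe_le (le_toSet_dMaxSmooth fun q hq p' hp' htv l hl => ?_)
  obtain ⟨σ, hσ, h⟩ := exists_mem_forall_typicalSet_le hF hp hn hη0 hη1 hηε hq hp' htv hl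
  have hT := one_sub_le_sum_typicalSet hp hn hη0 hη1
  set T := typicalSet p n (n * delta (Fintype.card X) n η)
  set L := l + blurCost (Fintype.card X) c n η ε with hLdef
  have hc := hF.c_pos
  have hlc := hF.logb_one_div_nonneg
  set Λ := n * Real.logb 2 (1 / c) with hΛ
  have hΛ0 : 0 ≤ Λ := by positivity
  obtain ⟨q₀, hq₀, hq₀F⟩ := hF.exists_iid_mem
  have hσs := hF.subset_simplex n hn hσ
  have hps := iid_mem_stdSimplex hp n
  have hP1 : ∑ x ∈ T, iid p n x ≤ 1 := by
    rw [← hps.2]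
    exact Finset.sum_le_sum_of_subset_of_nonneg (Finset.subset_univ _) fun x _ _ => hps.1 x
  have hcompl := Finset.sum_add_sum_compl T (iid p n)
  rw [hps.2] at hcompl
  have hP0 : 0 < ∑ x ∈ T, iid p n x := by linarith
  -- Summing the domination over `T`, where `σ` has mass at most `1`. Nonnegativity of `L` later
  -- allows the weight of `T` to be replaced by `1`.
  have hL0 : 0 ≤ L := by
    have h1 : ∑ x ∈ T, iid p n x ≤ (∑ x ∈ T, iid p n x) * 2 ^ L := by
      calc _ ≤ ∑ x ∈ T, (∑ y ∈ T, iid p n y) * 2 ^ L * σ x := Finset.sum_le_sum h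
        _ = (∑ y ∈ T, iid p n y) * 2 ^ L * ∑ x ∈ T, σ x := by rw [Finset.mul_sum]
        _ ≤ (∑ y ∈ T, iid p n y) * 2 ^ L * 1 := by
          gcongr
          rw [← hσs.2]
          exact Finset.sum_le_sum_of_subset_of_nonneg (Finset.subset_univ _) fun x _ _ => hσs.1 x
        _ = _ := mul_one _
    have h2 : (1 : ℝ) ≤ 2 ^ L := by
      by_contra! h3
      have := mul_lt_mul_of_pos_left h3 hP0
      linarith
    by_contra! h3
    exact absurd h2 (not_le.2 (Real.rpow_lt_one_of_one_lt_of_neg one_lt_two h3))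
  -- On `T` the `σ` half controls the log-ratio by `L + 1`; off `T`, a set of mass at most `η`, the
  -- full-support half controls it by `Λ + 1`.
  let r : (Fin n → X) → ℝ := fun x => (1 / 2) * σ x + (1 / 2) * iid q₀ n x
  have hr : r ∈ F n := by
    have := hF.convex n hn hσ (hq₀F n hn) (by norm_num : (0 : ℝ) ≤ 1 / 2)
      (by norm_num : (0 : ℝ) ≤ 1 / 2) (by norm_num)
    exact this
  have hq₀c : ∀ x : Fin n → X, c ^ n ≤ iid q₀ n x := fun x => pow_le_iid hc.le hq₀ x
  have hcn : 0 < c ^ n := by positivity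
  have hr0 : ∀ x, 0 < r x := fun x => by
    have := hσs.1 x
    have := hq₀c x
    simp only [r]
    linarith
  refine sub_coe_le_of_le_add_coe ((toSet_le hr).trans ?_)
  rw [relEnt, if_pos fun x hx => absurd hx (hr0 x).ne', ← EReal.coe_add, EReal.coe_le_coe_iff]
  have hin : ∀ x ∈ T, iid p n x * Real.logb 2 (iid p n x / r x) ≤ iid p n x * (L + 1) := by
    intro x hx
    refine mul_logb_div_le (hps.1 x) (hr0 x) ?_
    rw [Real.rpow_add_one two_pos.ne']
    calc _ ≤ _ := h x hx
      _ ≤ 1 * 2 ^ L * σ x := by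
        gcongr
        exact hσs.1 x
      _ ≤ 2 ^ L * 2 * r x := by
        have h2 : (0 : ℝ) < 2 ^ L := by positivity
        have : σ x ≤ 2 * r x := by
          have := hq₀c x
          simp only [r]; linarith
        nlinarith
  have hout : ∀ x ∈ Tᶜ, iid p n x * Real.logb 2 (iid p n x / r x) ≤ iid p n x * (Λ + 1) := by
    intro x _
    refine mul_logb_div_le (hps.1 x) (hr0 x) ?_
    rw [Real.rpow_add_one two_pos.ne']
    calc _ ≤ 1 := iid_le_one hp x
      _ = 2 ^ Λ * c ^ n := (two_rpow_mul_pow_eq_one hc n).symm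
      _ ≤ 2 ^ Λ * (2 * r x) := by
        gcongr
        have := hq₀c x
        have := hσs.1 x
        simp only [r]; linarith
      _ = _ := by ring
  rw [← Finset.sum_add_sum_compl T]
  have s1 := Finset.sum_le_sum hin
  have s2 := Finset.sum_le_sum hout
  rw [← Finset.sum_mul] at s1 s2
  have hC1 : ∑ x ∈ Tᶜ, iid p n x ≤ η := by linarith
  nlinarith [mul_le_mul_of_nonneg_right hP1 hL0, mul_le_mul_of_nonneg_right hC1 hΛ0]

end OneShot

/-! ### Comparison and finiteness of divergences from a set. -/

section Finiteness

variable {Ω : Type*} [Fintype Ω]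

lemma toSet_dMaxSmooth_nonneg {S : Set (Ω → ℝ)} (hS : S ⊆ stdSimplex ℝ Ω) (ε : ℝ) (p : Ω → ℝ) :
    0 ≤ toSet (dMaxSmooth ε) p S := by
  refine le_toSet_dMaxSmooth fun q hq p' hp' _ l hl => ?_
  have h : (1 : ℝ) ≤ 2 ^ l := by
    have := Finset.sum_le_sum fun x (_ : x ∈ Finset.univ) => hl x
    rwa [← Finset.mul_sum, hp'.2, (hS hq).2, mul_one] at this
  by_contra! hlt
  exact absurd h (not_le.2 (Real.rpow_lt_one_of_one_lt_of_neg one_lt_two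
    (by exact_mod_cast hlt)))

lemma exists_of_toSet_relEnt_lt {p : Ω → ℝ} {S : Set (Ω → ℝ)} {r : ℝ}
    (h : toSet relEnt p S < r) :
    ∃ q ∈ S, (∀ x, q x = 0 → p x = 0) ∧ ∑ x, p x * Real.logb 2 (p x / q x) < r := by
  simp only [toSet, iInf_lt_iff] at h
  obtain ⟨q, hq, h⟩ := h
  rw [relEnt] at h
  split_ifs at h with hac
  · exact ⟨q, hq, hac, by exact_mod_cast h⟩
  · exact absurd h not_top_lt

/-- A crude lower bound, enough for finiteness and Fekete's lemma: with smoothing `1 / 2`, Markov's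
bound gives `0 ≤ 2 * (D + 3) + 1`. -/
lemma neg_four_le_toSet_relEnt {p : Ω → ℝ} (hp : p ∈ stdSimplex ℝ Ω) {S : Set (Ω → ℝ)}
    (hS : S ⊆ stdSimplex ℝ Ω) : ((-4 : ℝ) : EReal) ≤ toSet relEnt p S := by
  by_contra! h
  obtain ⟨q, hq, hac, hlt⟩ := exists_of_toSet_relEnt_lt h
  have h1 := (toSet_dMaxSmooth_nonneg hS (1 / 2) p).trans ((toSet_le hq).trans
    (dMaxSmooth_le_of_relEnt hp (hS hq) hac one_half_pos one_half_lt_one))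
  have h2 : Real.logb 2 (1 / (1 - 1 / 2)) = 1 := by norm_num
  rw [h2] at h1
  have h3 : (0 : ℝ) ≤ (∑ x, p x * Real.logb 2 (p x / q x) + 3) / (1 / 2) + 1 := by
    exact_mod_cast h1
  linarith

/-- The constant `4` is the `3` from Markov's bound plus `1` for choosing a `q` that is only nearly
optimal. -/
lemma toSet_dMaxSmooth_le_relEnt {p : Ω → ℝ} (hp : p ∈ stdSimplex ℝ Ω) {S : Set (Ω → ℝ)}
    (hS : S ⊆ stdSimplex ℝ Ω) {u : ℝ} (hu : toSet relEnt p S = u) {θ : ℝ} (h0 : 0 < θ)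
    (h1 : θ < 1) :
    toSet (dMaxSmooth θ) p S ≤ ((u + 4) / θ + Real.logb 2 (1 / (1 - θ)) : ℝ) := by
  obtain ⟨q, hq, hac, hlt⟩ := exists_of_toSet_relEnt_lt (p := p) (S := S) (r := u + 1)
    (by rw [hu]; exact_mod_cast lt_add_one u)
  refine (toSet_le hq).trans ((dMaxSmooth_le_of_relEnt hp (hS hq) hac h0 h1).trans ?_)
  rw [EReal.coe_le_coe_iff]
  gcongr ?_ / _ + _
  linarith

lemma toSet_dHyp_le {p : Ω → ℝ} (hp : p ∈ stdSimplex ℝ Ω) {S : Set (Ω → ℝ)} {ε η : ℝ}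
    (hε : 0 ≤ ε) (hεη : ε + η < 1) :
    toSet (dHyp ε) p S ≤ toSet (dMaxSmooth η) p S + (Real.logb 2 (1 / (1 - ε - η)) : ℝ) := by
  refine le_add_coe_of_sub_coe_le (le_toSet_dMaxSmooth fun q hq p' hp' htv l hl => ?_)
  refine sub_coe_le_of_le_add_coe ((toSet_le hq).trans ?_)
  rw [← EReal.coe_add]
  exact dHyp_le_of_forall_le hp hp' hε hεη htv hl

lemma toSet_dMaxSmooth_sub_le_dHyp {p : Ω → ℝ} (hp : p ∈ stdSimplex ℝ Ω) {S : Set (Ω → ℝ)}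
    (hS : S ⊆ stdSimplex ℝ Ω) {ε : ℝ} (h0 : 0 < ε) :
    toSet (dMaxSmooth (1 - ε)) p S - (Real.logb 2 (1 / ε) : ℝ) ≤ toSet (dHyp ε) p S :=
  le_iInf₂ fun _ hq => (EReal.sub_le_sub (toSet_le hq) le_rfl).trans
    (dMaxSmooth_sub_le_dHyp hp (hS hq).1 h0)

lemma exists_coe_eq {x : EReal} {a b : ℝ} (ha : (a : EReal) ≤ x) (hb : x ≤ (b : EReal)) :
    ∃ r : ℝ, x = r :=
  ⟨x.toReal, (EReal.coe_toReal (ne_top_of_le_ne_top (EReal.coe_ne_top b) hb)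
    (ne_bot_of_le_ne_bot (EReal.coe_ne_bot a) ha)).symm⟩

end Finiteness

/-! ### Subadditivity and the asymptotic rates. -/

section Asymptotics

variable {X : Type*} [Fintype X] {F : (n : ℕ) → Set ((Fin n → X) → ℝ)} {c : ℝ}

lemma BrandaoPlenio.exists_toSet_relEnt_eq (hF : BrandaoPlenio F c) {p : X → ℝ}
    (hp : p ∈ stdSimplex ℝ X) {n : ℕ} (hn : 1 ≤ n) :
    ∃ r : ℝ, -4 ≤ r ∧ toSet relEnt (iid p n) (F n) = r := by
  obtain ⟨q₀, hq₀, hq₀F⟩ := hF.exists_iid_mem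
  have hc := hF.c_pos
  have hps := iid_mem_stdSimplex hp n
  have hq : ∀ x : Fin n → X, c ^ n ≤ iid q₀ n x := fun x => pow_le_iid hc.le hq₀ x
  have hq0 : ∀ x : Fin n → X, 0 < iid q₀ n x := fun x => (by positivity : 0 < c ^ n).trans_le (hq x)
  have hlow := neg_four_le_toSet_relEnt hps (hF.subset_simplex n hn)
  have hup : toSet relEnt (iid p n) (F n) ≤ (n * Real.logb 2 (1 / c) : ℝ) := by
    refine (toSet_le (hq₀F n hn)).trans ?_
    rw [relEnt, if_pos fun x hx => absurd hx (hq0 x).ne', EReal.coe_le_coe_iff]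
    calc _ ≤ ∑ x, iid p n x * (n * Real.logb 2 (1 / c)) := by
          refine Finset.sum_le_sum fun x _ => mul_logb_div_le (hps.1 x) (hq0 x) ?_
          exact ((iid_le_one hp x).trans (two_rpow_mul_pow_eq_one hc n).ge).trans
            (mul_le_mul_of_nonneg_left (hq x) (by positivity))
      _ = _ := by rw [← Finset.sum_mul, hps.2, one_mul]
  obtain ⟨r, hr⟩ := exists_coe_eq hlow hup
  rw [hr] at hlow
  exact ⟨r, by exact_mod_cast hlow, hr⟩

lemma BrandaoPlenio.exists_toSet_dMaxSmooth_eq (hF : BrandaoPlenio F c) {p : X → ℝ}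
    (hp : p ∈ stdSimplex ℝ X) {n : ℕ} (hn : 1 ≤ n) {ε : ℝ} (h0 : 0 < ε) (h1 : ε < 1) :
    ∃ r : ℝ, toSet (dMaxSmooth ε) (iid p n) (F n) = r := by
  obtain ⟨u, -, hu⟩ := hF.exists_toSet_relEnt_eq hp hn
  exact exists_coe_eq (by exact_mod_cast toSet_dMaxSmooth_nonneg (hF.subset_simplex n hn) ε _)
    (toSet_dMaxSmooth_le_relEnt (iid_mem_stdSimplex hp n) (hF.subset_simplex n hn) hu h0 h1)

lemma BrandaoPlenio.exists_toSet_dHyp_eq (hF : BrandaoPlenio F c) {p : X → ℝ}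
    (hp : p ∈ stdSimplex ℝ X) {n : ℕ} (hn : 1 ≤ n) {ε : ℝ} (h0 : 0 < ε) (h1 : ε < 1) :
    ∃ r : ℝ, toSet (dHyp ε) (iid p n) (F n) = r := by
  obtain ⟨a, ha⟩ := hF.exists_toSet_dMaxSmooth_eq hp hn (sub_pos.2 h1) (by linarith : 1 - ε < 1)
  obtain ⟨b, hb⟩ := hF.exists_toSet_dMaxSmooth_eq hp hn (ε := (1 - ε) / 2) (by linarith)
    (by linarith)
  have hlow := toSet_dMaxSmooth_sub_le_dHyp (iid_mem_stdSimplex hp n) (hF.subset_simplex n hn) h0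
  have hup := toSet_dHyp_le (iid_mem_stdSimplex hp n) (S := F n) h0.le
    (by linarith : ε + (1 - ε) / 2 < 1)
  rw [ha, ← EReal.coe_sub] at hlow
  rw [hb, ← EReal.coe_add] at hup
  exact exists_coe_eq hlow hup

lemma sum_mul_logb_tensor {p : X → ℝ} (hp : p ∈ stdSimplex ℝ X) {n m : ℕ}
    {q : (Fin n → X) → ℝ} {q' : (Fin m → X) → ℝ} (hq : ∀ x, q x = 0 → iid p n x = 0)
    (hq' : ∀ x, q' x = 0 → iid p m x = 0) :
    ∑ x, iid p (n + m) x * Real.logb 2 (iid p (n + m) x / tensor q q' x) =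
      ∑ x, iid p n x * Real.logb 2 (iid p n x / q x) +
        ∑ x, iid p m x * Real.logb 2 (iid p m x / q' x) := by
  rw [sum_append]
  have hterm : ∀ (y : Fin n → X) (z : Fin m → X),
      iid p (n + m) (Fin.append y z) *
        Real.logb 2 (iid p (n + m) (Fin.append y z) / tensor q q' (Fin.append y z)) =
      (iid p n y * Real.logb 2 (iid p n y / q y)) * iid p m z +
        iid p n y * (iid p m z * Real.logb 2 (iid p m z / q' z)) := by
    intro y z
    rw [iid_append, tensor_append]
    by_cases hy : iid p n y = 0
    · simp [hy]
    by_cases hz : iid p m z = 0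
    · simp [hz]
    rw [mul_div_mul_comm, Real.logb_mul (div_ne_zero hy fun h => hy (hq y h))
      (div_ne_zero hz fun h => hz (hq' z h))]
    ring
  simp only [hterm, Finset.sum_add_distrib, ← Finset.mul_sum, ← Finset.sum_mul,
    (iid_mem_stdSimplex hp n).2, (iid_mem_stdSimplex hp m).2, mul_one, one_mul]

lemma BrandaoPlenio.toSet_relEnt_add_le (hF : BrandaoPlenio F c) {p : X → ℝ}
    (hp : p ∈ stdSimplex ℝ X) {n m : ℕ} (hn : 1 ≤ n) (hm : 1 ≤ m) {a b : ℝ}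
    (ha : toSet relEnt (iid p n) (F n) = a) (hb : toSet relEnt (iid p m) (F m) = b) :
    toSet relEnt (iid p (n + m)) (F (n + m)) ≤ (a + b : ℝ) := by
  refine EReal.le_of_forall_lt_iff_le.1 fun z hz => ?_
  rw [EReal.coe_lt_coe_iff] at hz
  obtain ⟨q, hq, hac, hlt⟩ := exists_of_toSet_relEnt_lt (p := iid p n) (S := F n)
    (r := a + (z - (a + b)) / 2) (by rw [ha]; exact_mod_cast (by linarith))
  obtain ⟨q', hq', hac', hlt'⟩ := exists_of_toSet_relEnt_lt (p := iid p m) (S := F m)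
    (r := b + (z - (a + b)) / 2) (by rw [hb]; exact_mod_cast (by linarith))
  refine (toSet_le (hF.tensor_mem n m hn hm q hq q' hq')).trans ?_
  rw [relEnt, if_pos, sum_mul_logb_tensor hp hac hac', EReal.coe_le_coe_iff]
  · linarith
  · intro x hx
    rw [← Fin.append_castAdd_natAdd (f := x), tensor_append, mul_eq_zero] at hx
    rw [← Fin.append_castAdd_natAdd (f := x), iid_append, mul_eq_zero]
    exact hx.imp (hac _) (hac' _)

lemma tendsto_delta (K : ℕ) {η : ℝ} (hη : 0 < η) :
    Tendsto (fun n : ℕ => delta K n η) atTop (𝓝 0) := by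
  have hlog : Tendsto (fun n : ℕ => Real.log (n + 1) / n) atTop (𝓝 0) := by
    -- At `x = n + 1` the denominator `1 * x + (-1)` equals `n`.
    have h := (Real.tendsto_pow_log_div_mul_add_atTop 1 (-1) 1 one_ne_zero).comp
      (tendsto_atTop_add_const_right atTop (1 : ℝ) tendsto_natCast_atTop_atTop)
    refine h.congr fun n => ?_
    simp
  have hconst : Tendsto (fun n : ℕ => Real.log η / n) atTop (𝓝 0) :=
    tendsto_const_div_atTop_nhds_zero_nat _
  have h := (hlog.sub hconst).const_mul (K / (2 * Real.log 2))
  simp only [sub_zero, mul_zero] at h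
  have hs := (Real.continuous_sqrt.tendsto 0).comp h
  rw [Real.sqrt_zero] at hs
  refine hs.congr fun n => ?_
  simp only [Function.comp_apply, delta, Real.logb]
  congr 1
  rw [Real.log_div (by positivity) hη.ne']
  field_simp

lemma tendsto_blurCost_div (K : ℕ) (c : ℝ) {η : ℝ} (ε : ℝ) (hη : 0 < η) :
    Tendsto (fun n : ℕ => blurCost K c n η ε / n) atTop (𝓝 0) := by
  have h1 : Tendsto (fun n : ℕ => 2 * delta K n η + 1 / (n : ℝ)) atTop (𝓝 0) := by
    simpa using ((tendsto_delta K hη).const_mul 2).add tendsto_one_div_atTop_nhds_zero_nat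
  have h2 := h1.mul_const (K : ℝ)
  rw [zero_mul] at h2
  have h3 := ((continuous_g.tendsto 0).comp h2).const_mul 2
  rw [g_zero, mul_zero] at h3
  have h4 := h2.mul_const (Real.logb 2 (1 / c))
  rw [zero_mul] at h4
  have h5 := ((tendsto_const_div_atTop_nhds_zero_nat (Real.logb 2 (1 / (1 - ε - η)))).add h3).add h4
  simp only [add_zero] at h5
  refine h5.congr' ((eventually_ge_atTop 1).mono fun n hn => ?_)
  have hn' : (n : ℝ) ≠ 0 := by exact_mod_cast (by omega : n ≠ 0)
  simp only [Function.comp_apply, blurCost]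
  field_simp

lemma tendsto_inv_mul_coe {f : ℕ → EReal} {v : ℕ → ℝ} {L : ℝ} (hf : ∀ n, 1 ≤ n → f n = v n)
    (hv : Tendsto (fun n => v n / n) atTop (𝓝 L)) :
    Tendsto (fun n : ℕ => (((n : ℝ)⁻¹ : ℝ) : EReal) * f n) atTop (𝓝 (L : EReal)) := by
  refine (EReal.tendsto_coe.2 hv).congr' ((eventually_ge_atTop 1).mono fun n hn => ?_)
  beta_reduce
  rw [hf n hn, ← EReal.coe_mul, div_eq_inv_mul]

/-- Existence and finiteness of the regularised relative entropy. -/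
lemma BrandaoPlenio.exists_tendsto_relEnt_div (hF : BrandaoPlenio F c) {p : X → ℝ}
    (hp : p ∈ stdSimplex ℝ X) :
    ∃ (u : ℕ → ℝ) (L : ℝ), (∀ n, 1 ≤ n → toSet relEnt (iid p n) (F n) = u n) ∧
      Tendsto (fun n => u n / n) atTop (𝓝 L) := by
  choose! v hv4 hv using fun n (hn : 1 ≤ n) => hF.exists_toSet_relEnt_eq hp hn
  -- The axioms say nothing about `F 0`; the value `0` keeps the sequence subadditive at index `0`.
  let u : ℕ → ℝ := fun n => if n = 0 then 0 else v n
  have hu : ∀ n, 1 ≤ n → u n = v n := fun n hn => if_neg (by omega)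
  have hsub : Subadditive u := by
    intro n m
    rcases Nat.eq_zero_or_pos n with rfl | hn
    · simp [u]
    rcases Nat.eq_zero_or_pos m with rfl | hm
    · simp [u]
    rw [hu n hn, hu m hm, hu (n + m) (by omega)]
    have := hF.toSet_relEnt_add_le hp hn hm (hv n hn) (hv m hm)
    rw [hv (n + m) (by omega)] at this
    exact_mod_cast this
  refine ⟨u, hsub.lim, fun n hn => by rw [hu n hn, hv n hn], hsub.tendsto_lim ⟨-4, ?_⟩⟩
  rintro _ ⟨n, rfl⟩
  rcases Nat.eq_zero_or_pos n with rfl | hn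
  · simp
  have hn' : (1 : ℝ) ≤ n := by exact_mod_cast hn
  beta_reduce
  rw [hu n hn, le_div_iff₀ (by linarith)]
  linarith [hv4 n hn]

/-- The lower bound is `toSet_relEnt_le`, whose asymptotic loss `η * Λ` vanishes with `η`. The upper
bound is Markov's at smoothing `θ`, with limiting rate `L / θ`, transferred from `θ` down to at most
`ε` by the one-shot bound at sublinear cost; then `θ` is taken close to `1`. -/
lemma BrandaoPlenio.tendsto_dMaxSmooth_div (hF : BrandaoPlenio F c) {p : X → ℝ}
    (hp : p ∈ stdSimplex ℝ X) {u : ℕ → ℝ} {L : ℝ}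
    (hu : ∀ n, 1 ≤ n → toSet relEnt (iid p n) (F n) = u n)
    (hL : Tendsto (fun n => u n / n) atTop (𝓝 L)) {ε : ℝ} (h0 : 0 < ε) (h1 : ε < 1) {M : ℕ → ℝ}
    (hM : ∀ n, 1 ≤ n → toSet (dMaxSmooth ε) (iid p n) (F n) = M n) :
    Tendsto (fun n => M n / n) atTop (𝓝 L) := by
  set Λ := Real.logb 2 (1 / c)
  have hΛ : 0 ≤ Λ := hF.logb_one_div_nonneg
  set K := Fintype.card X
  refine tendsto_order.2 ⟨fun a ha => ?_, fun b hb => ?_⟩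
  · obtain ⟨η, hη0, hηε, hηa⟩ : ∃ η : ℝ, 0 < η ∧ η + ε < 1 ∧ a < L - η * Λ := by
      -- The `+ 1` covers the case `Λ = 0`.
      refine ⟨min ((1 - ε) / 2) ((L - a) / (2 * (Λ + 1))), ?_, ?_, ?_⟩
      · have : 0 < L - a := by linarith
        have : 0 < 1 - ε := by linarith
        positivity
      · linarith [min_le_left ((1 - ε) / 2) ((L - a) / (2 * (Λ + 1)))]
      · have h2 : min ((1 - ε) / 2) ((L - a) / (2 * (Λ + 1))) * (Λ + 1) ≤ (L - a) / 2 := by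
          calc _ ≤ (L - a) / (2 * (Λ + 1)) * (Λ + 1) := by
                gcongr
                exact min_le_right _ _
            _ = (L - a) / 2 := by field_simp
        have h3 : 0 < min ((1 - ε) / 2) ((L - a) / (2 * (Λ + 1))) := by
          have : 0 < L - a := by linarith
          have : 0 < 1 - ε := by linarith
          positivity
        linarith
    have hlim : Tendsto (fun n : ℕ => u n / n - blurCost K c n η ε / n - 1 / n - η * Λ) atTop
        (𝓝 (L - η * Λ)) := by
      simpa using ((hL.sub (tendsto_blurCost_div K c ε hη0)).sub
        tendsto_one_div_atTop_nhds_zero_nat).sub_const (η * Λ)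
    filter_upwards [hlim.eventually_const_lt hηa, eventually_ge_atTop 1] with n hn hn1
    have hn' : (0 : ℝ) < n := by exact_mod_cast hn1
    have h := toSet_relEnt_le hF hp hn1 hη0 (by linarith) hηε
    rw [hu n hn1, hM n hn1, ← EReal.coe_add, EReal.coe_le_coe_iff] at h
    refine hn.trans_le ?_
    have e : u n / n - blurCost K c n η ε / n - 1 / n - η * Λ =
        (u n - blurCost K c n η ε - 1 - η * (n * Λ)) / n := by field_simp
    rw [e]
    exact div_le_div_of_nonneg_right (by linarith) hn'.le
  · obtain ⟨θ, hθb, hθ0, hθ1⟩ : ∃ θ : ℝ, L / θ < b ∧ 0 < θ ∧ θ < 1 := by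
      have hc : Tendsto (fun θ : ℝ => L / θ) (𝓝[<] 1) (𝓝 L) := by
        have : ContinuousAt (fun θ : ℝ => L / θ) 1 :=
          continuousAt_const.div continuousAt_id one_ne_zero
        simpa using this.tendsto.mono_left nhdsWithin_le_nhds
      exact ((hc.eventually_lt_const hb).and
        (Ioo_mem_nhdsLT (zero_lt_one : (0 : ℝ) < 1))).exists
    set η := min ε ((1 - θ) / 2)
    have hη0 : 0 < η := lt_min h0 (by linarith)
    have hηθ : η + θ < 1 := by linarith [min_le_right ε ((1 - θ) / 2)]
    have hlim : Tendsto (fun n : ℕ => (u n / n + 4 / n) / θ + Real.logb 2 (1 / (1 - θ)) / n +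
        blurCost K c n η θ / n) atTop (𝓝 (L / θ)) := by
      simpa using (((hL.add (tendsto_const_div_atTop_nhds_zero_nat 4)).div_const θ).add
        (tendsto_const_div_atTop_nhds_zero_nat (Real.logb 2 (1 / (1 - θ))))).add
        (tendsto_blurCost_div K c θ hη0)
    filter_upwards [hlim.eventually_lt_const hθb, eventually_ge_atTop 1] with n hn hn1
    have hn' : (0 : ℝ) < n := by exact_mod_cast hn1
    have h2 := toSet_dMaxSmooth_le_relEnt (iid_mem_stdSimplex hp n) (hF.subset_simplex n hn1)
      (hu n hn1) hθ0 hθ1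
    have h3 := (dMaxSmooth_anti (min_le_left ε ((1 - θ) / 2)) (iid p n) (F n)).trans
      ((toSet_dMaxSmooth_le hF hp hn1 hη0 (by linarith) hηθ).trans (add_le_add_left h2 _))
    rw [hM n hn1, ← EReal.coe_add, EReal.coe_le_coe_iff] at h3
    refine lt_of_le_of_lt ?_ hn
    have e : (u n / n + 4 / n) / θ + Real.logb 2 (1 / (1 - θ)) / n + blurCost K c n η θ / n =
        ((u n + 4) / θ + Real.logb 2 (1 / (1 - θ)) + blurCost K c n η θ) / n := by field_simp
    rw [e]
    exact div_le_div_of_nonneg_right h3 hn'.le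

lemma BrandaoPlenio.tendsto_dMaxRate (hF : BrandaoPlenio F c) {p : X → ℝ}
    (hp : p ∈ stdSimplex ℝ X) {u : ℕ → ℝ} {L : ℝ}
    (hu : ∀ n, 1 ≤ n → toSet relEnt (iid p n) (F n) = u n)
    (hL : Tendsto (fun n => u n / n) atTop (𝓝 L)) {ε : ℝ} (h0 : 0 < ε) (h1 : ε < 1) :
    Tendsto (dMaxRate ε p F) atTop (𝓝 (L : EReal)) := by
  choose! M hM using fun n (hn : 1 ≤ n) => hF.exists_toSet_dMaxSmooth_eq hp hn h0 h1
  exact tendsto_inv_mul_coe hM (hF.tendsto_dMaxSmooth_div hp hu hL h0 h1 hM)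

/-- Squeezed between smoothings `1 - ε` and `(1 - ε) / 2`; both lie in `(0, 1)`, and the second
keeps `ε + η < 1`. -/
lemma BrandaoPlenio.tendsto_dHypRate (hF : BrandaoPlenio F c) {p : X → ℝ}
    (hp : p ∈ stdSimplex ℝ X) {u : ℕ → ℝ} {L : ℝ}
    (hu : ∀ n, 1 ≤ n → toSet relEnt (iid p n) (F n) = u n)
    (hL : Tendsto (fun n => u n / n) atTop (𝓝 L)) {ε : ℝ} (h0 : 0 < ε) (h1 : ε < 1) :
    Tendsto (dHypRate ε p F) atTop (𝓝 (L : EReal)) := by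
  have hε : 0 < 1 - ε := by linarith
  have hε' : 0 < (1 - ε) / 2 := by linarith
  choose! A hA using fun n (hn : 1 ≤ n) =>
    hF.exists_toSet_dMaxSmooth_eq hp hn hε (by linarith : 1 - ε < 1)
  choose! B hB using fun n (hn : 1 ≤ n) =>
    hF.exists_toSet_dMaxSmooth_eq hp hn hε' (by linarith : (1 - ε) / 2 < 1)
  choose! H hH using fun n (hn : 1 ≤ n) => hF.exists_toSet_dHyp_eq hp hn h0 h1
  have hA' := hF.tendsto_dMaxSmooth_div hp hu hL hε (by linarith) hA
  have hB' := hF.tendsto_dMaxSmooth_div hp hu hL hε' (by linarith) hB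
  refine tendsto_inv_mul_coe hH ?_
  have hlow : Tendsto (fun n : ℕ => A n / n - Real.logb 2 (1 / ε) / n) atTop (𝓝 L) := by
    simpa using hA'.sub (tendsto_const_div_atTop_nhds_zero_nat (Real.logb 2 (1 / ε)))
  have hup : Tendsto (fun n : ℕ => B n / n + Real.logb 2 (1 / (1 - ε - (1 - ε) / 2)) / n) atTop
      (𝓝 L) := by
    simpa using hB'.add
      (tendsto_const_div_atTop_nhds_zero_nat (Real.logb 2 (1 / (1 - ε - (1 - ε) / 2))))
  refine tendsto_of_tendsto_of_tendsto_of_le_of_le' hlow hup ?_ ?_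
  all_goals
    filter_upwards [eventually_ge_atTop 1] with n hn
    have hn' : (0 : ℝ) < n := by exact_mod_cast hn
  · have h := toSet_dMaxSmooth_sub_le_dHyp (iid_mem_stdSimplex hp n) (hF.subset_simplex n hn) h0
    rw [hA n hn, hH n hn, ← EReal.coe_sub, EReal.coe_le_coe_iff] at h
    rw [← sub_div]
    exact div_le_div_of_nonneg_right h hn'.le
  · have h := toSet_dHyp_le (iid_mem_stdSimplex hp n) (S := F n) h0.le
      (by linarith : ε + (1 - ε) / 2 < 1)
    rw [hB n hn, hH n hn, ← EReal.coe_add, EReal.coe_le_coe_iff] at h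
    rw [← add_div]
    exact div_le_div_of_nonneg_right h hn'.le

end Asymptotics

end GenStein

end

theorem theorem2 {X : Type*} [Fintype X] (F : (n : ℕ) → Set ((Fin n → X) → ℝ)) (c : ℝ)
    (hF : GenStein.BrandaoPlenio F c) (p : X → ℝ) (hp : p ∈ stdSimplex ℝ X) :
    -- one-shot bound
    (∀ n : ℕ, 1 ≤ n → ∀ η ε : ℝ, 0 < η → η < 1 → 0 < ε → ε < 1 → η + ε < 1 →
      GenStein.toSet (GenStein.dMaxSmooth η) (GenStein.iid p n) (F n) ≤
        GenStein.toSet (GenStein.dMaxSmooth ε) (GenStein.iid p n) (F n) +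
          ((Real.logb 2 (1 / (1 - ε - η))
            + 2 * n * GenStein.g
                ((2 * GenStein.delta (Fintype.card X) n η + 1 / n) * Fintype.card X)
            + (2 * n * GenStein.delta (Fintype.card X) n η + 1) * Fintype.card X
                * Real.logb 2 (1 / c) : ℝ) : EReal)) ∧
    -- the limits defining the regularised relative entropy and the Stein exponent exist
    Tendsto (GenStein.relEntRate p F) atTop (𝓝 (GenStein.regRelEnt p F)) ∧
    Tendsto (fun ε : ℝ => liminf (GenStein.dHypRate ε p F) atTop) (𝓝[>] 0)
      (𝓝 (GenStein.stein p F)) ∧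
    -- and are finite
    (∃ d : ℝ, GenStein.regRelEnt p F = (d : EReal)) ∧
    -- asymptotic statement
    (∀ ε : ℝ, 0 < ε → ε < 1 →
      Tendsto (GenStein.dMaxRate ε p F) atTop (𝓝 (GenStein.regRelEnt p F))) ∧
    GenStein.regRelEnt p F = GenStein.stein p F := by
  obtain ⟨u, L, hu, hL⟩ := hF.exists_tendsto_relEnt_div hp
  have hrel : Tendsto (GenStein.relEntRate p F) atTop (𝓝 (L : EReal)) :=
    GenStein.tendsto_inv_mul_coe hu hL
  have hstein : Tendsto (fun ε : ℝ => liminf (GenStein.dHypRate ε p F) atTop) (𝓝[>] 0)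
      (𝓝 (L : EReal)) := by
    -- For each `ε` in `(0, 1)` the liminf already equals `L`, so the function of `ε` is constant
    -- near `0⁺`.
    refine tendsto_const_nhds.congr' ?_
    filter_upwards [Ioo_mem_nhdsGT (zero_lt_one : (0 : ℝ) < 1)] with ε hε
    exact (hF.tendsto_dHypRate hp hu hL hε.1 hε.2).liminf_eq.symm
  have hreg : GenStein.regRelEnt p F = L := hrel.limUnder_eq
  have hst : GenStein.stein p F = L := hstein.limUnder_eq
  rw [hreg, hst]
  exact ⟨fun n hn η ε hη0 hη1 _ _ hηε => GenStein.toSet_dMaxSmooth_le hF hp hn hη0 hη1 hηε,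
    hrel, hstein, ⟨L, rfl⟩, fun ε h0 h1 => hF.tendsto_dMaxRate hp hu hL h0 h1, rfl⟩
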